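/- **Conventions.** Let $\mathcal V$ be a symmetric monoidal model category: a model category with a closed symmetric monoidal structure $(\otimes,\mathbb 1,\underline{\mathcal V}(-,-))$ satisfying the pushout-product axiom and the unit axiom (for every cofibrant $x$ and every weak equivalence $q\colon Q\mathbb 1\to\mathbb 1$ with $Q\mathbb 1$ cofibrant, $x\otimes Q\mathbb 1\to x\otimes\mathbb 1\cong x$ is a weak equivalence). Let $\mathcal C$ be a $\mathcal V$-enriched model category: a $\mathcal V$-category with hom objects $\underline{\mathcal C}(x,y)$ and a model structure on its underlying category, where the initial object $\varnothing$ and the terminal object $*$ of $\mathcal C$ are so in the enriched sense, i.e. $\underline{\mathcal C}(\varnothing,y)$ and $\underline{\mathcal C}(x,*)$ are terminal in $\mathcal V$ for all $x,y$. Let $\gamma$ denote the localization functors $\mathcal V\to\mathrm{Ho}(\mathcal V)$ and $\mathcal C\to\mathrm{Ho}(\mathcal C)$ at the weak equivalences, and $[-,-]$ the hom-sets of the homotopy categories. * **SM7:** for every cofibration $i\colon a\to b$ and fibration $p\colon x\to y$ in $\mathcal C$, the map $\underline{\mathcal C}(b,x)\to\underline{\mathcal C}(a,x)\times_{\underline{\mathcal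 C}(a,y)}\underline{\mathcal C}(b,y)$ is a fibration in $\mathcal V$, which is acyclic if $i$ or $p$ is. * **$\pi_0$ of mapping space axiom:** for $x$ cofibrant and $y$ fibrant in $\mathcal C$, the canonical map $[x,y]\to[\mathbb 1,\underline{\mathcal C}(x,y)]$, sending the class of $f\colon x\to y$ to the class of the corresponding map $\mathbb 1\to\underline{\mathcal C}(x,y)$, is a bijection. * A **weak tensoring** of $\mathcal C$ over $\mathcal V$ is a bifunctor $-\otimes-\colon\mathcal C\times\mathcal V\to\mathcal C$ satisfying the external pushout-product axiom (the pushout-product of a cofibration of $\mathcal C$ and a cofibration of $\mathcal V$ is a cofibration, acyclic if one of the two is), together with maps $\varphi_{v,x,y}\colon\underline{\mathcal C}(x\otimes v,y)\to\underline{\mathcal V}(v,\underline{\mathcal C}(x,y))$, natural in $v$ and $x$ and $\mathcal V$-natural in $y$, which are weak equivalences for $v,x$ cofibrant and $y$ fibrant, and a natural map $\rho_x\colon x\otimes\mathbb 1\to x$ such that $\varphi_{\mathbb 1,x,y}\circ\rho_x^*$ is the canonical isomorphism $\underline{\mathcal C}(x,y)\cong\underline{\mathcal V}(\mathbb 1,\underline{\mathcal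 C}(x,y))$. * Dually, a **weak cotensoring** is a bifunctor $(y,v)\mapsto y^v$, $\mathcal C\times\mathcal V^{\mathrm{op}}\to\mathcal C$, satisfying the external pullback-power axiom (for a cofibration $i\colon a\to b$ of $\mathcal V$ and a fibration $p\colon x\to y$ of $\mathcal C$, the map $x^b\to x^a\times_{y^a}y^b$ is a fibration, acyclic if $i$ or $p$ is), with maps $\psi_{v,x,y}\colon\underline{\mathcal C}(x,y^v)\to\underline{\mathcal V}(v,\underline{\mathcal C}(x,y))$, natural in $v$ and $y$ and $\mathcal V$-natural in $x$, which are weak equivalences for $v,x$ cofibrant and $y$ fibrant, and a natural map $\eta_y\colon y\to y^{\mathbb 1}$ such that $\psi_{\mathbb 1,x,y}\circ(\eta_y)_*$ is the canonical isomorphism. **Proposition.** Let $\mathcal C$ be a $\mathcal V$-enriched model category satisfying SM7 and the $\pi_0$ of mapping space axiom. 0. $\mathrm{Ho}(\mathcal V)$ has a derived closed symmetric monoidal structure: one for which $\gamma\colon\mathcal V\to\mathrm{Ho}(\mathcal V)$ is lax symmetric monoidal, with $\mathbb 1\to\gamma\mathbb 1$ an isomorphism and $\gamma x\otimes\gamma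 y\to\gamma(x\otimes y)$ an isomorphism for $x,y$ cofibrant. Fix any such structure. 1. $\mathrm{Ho}(\mathcal C)$ inherits a $\mathrm{Ho}(\mathcal V)$-enrichment: there is a $\mathrm{Ho}(\mathcal V)$-category whose underlying category is the usual $\mathrm{Ho}(\mathcal C)$, together with maps $\Gamma_{x,y}\colon\gamma\,\underline{\mathcal C}(x,y)\to\underline{\mathrm{Ho}(\mathcal C)}(\gamma x,\gamma y)$ for $x,y\in\mathcal C$ that are compatible with identities and composition, induce $\gamma$ on underlying morphisms, and are isomorphisms for $x$ cofibrant and $y$ fibrant. Fix any such enrichment. 2. For every weak tensoring of $\mathcal C$ over $\mathcal V$, $\mathrm{Ho}(\mathcal C)$ has an induced tensoring over $\mathrm{Ho}(\mathcal V)$, i.e. objects $X\otimes W$ with isomorphisms $\underline{\mathrm{Ho}(\mathcal C)}(X\otimes W,Y)\cong\underline{\mathrm{Ho}(\mathcal V)}(W,\underline{\mathrm{Ho}(\mathcal C)}(X,Y))$ that are $\mathrm{Ho}(\mathcal V)$-natural in $Y$. Induced means that for $x\in\mathcal C$ and $v\in\mathcal V$ cofibrant there is an isomorphism $\gamma x\otimes\gamma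 v\cong\gamma(x\otimes v)$ under which, for all $y\in\mathcal C$, the composite of $\Gamma_{x\otimes v,y}$ with the tensoring isomorphism equals the composite $\gamma\,\underline{\mathcal C}(x\otimes v,y)\xrightarrow{\gamma\varphi}\gamma\,\underline{\mathcal V}(v,\underline{\mathcal C}(x,y))\to\underline{\mathrm{Ho}(\mathcal V)}(\gamma v,\gamma\,\underline{\mathcal C}(x,y))\xrightarrow{\Gamma_*}\underline{\mathrm{Ho}(\mathcal V)}(\gamma v,\underline{\mathrm{Ho}(\mathcal C)}(\gamma x,\gamma y))$, whose middle map is the canonical one. 3. For every weak cotensoring of $\mathcal C$ over $\mathcal V$, $\mathrm{Ho}(\mathcal C)$ has an induced cotensoring over $\mathrm{Ho}(\mathcal V)$, i.e. objects $Y^W$ with isomorphisms $\underline{\mathrm{Ho}(\mathcal C)}(X,Y^W)\cong\underline{\mathrm{Ho}(\mathcal V)}(W,\underline{\mathrm{Ho}(\mathcal C)}(X,Y))$ that are $\mathrm{Ho}(\mathcal V)$-natural in $X$. Induced means that for $y$ fibrant and $v$ cofibrant there is an isomorphism $(\gamma y)^{\gamma v}\cong\gamma(y^v)$ under which, for all $x\in\mathcal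 C$, the composite of $\Gamma_{x,y^v}$ with the cotensoring isomorphism equals the composite $\gamma\,\underline{\mathcal C}(x,y^v)\xrightarrow{\gamma\psi}\gamma\,\underline{\mathcal V}(v,\underline{\mathcal C}(x,y))\to\underline{\mathrm{Ho}(\mathcal V)}(\gamma v,\gamma\,\underline{\mathcal C}(x,y))\xrightarrow{\Gamma_*}\underline{\mathrm{Ho}(\mathcal V)}(\gamma v,\underline{\mathrm{Ho}(\mathcal C)}(\gamma x,\gamma y))$. -/

import Mathlib

open CategoryTheory Category MonoidalCategory Limits Opposite HomotopicalAlgebra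

universe v₁ v₂ v₃ v₄ u₁ u₂ u₃ u₄

noncomputable section

namespace EnrichedModel

/-! ### Axioms on bifunctors between model categories -/

section Axioms

variable {C₁ : Type u₁} [Category.{v₁} C₁] [ModelCategory C₁]
  {C₂ : Type u₂} [Category.{v₂} C₂] [ModelCategory C₂]
  {C₃ : Type u₃} [Category.{v₃} C₃] [ModelCategory C₃]

/-- The pushout-product axiom for a bifunctor `F : C₁ × C₂ → C₃`: the pushout-product of two
cofibrations is a cofibration, which is moreover acyclic if one of the two is. -/
structure PushoutProductAxiom (F : C₁ ⥤ C₂ ⥤ C₃) : Prop where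
  cofibration {a b : C₁} (i : a ⟶ b) {x y : C₂} (k : x ⟶ y) [Cofibration i] [Cofibration k]
    (sq : F.PushoutObjObj i k) : Cofibration sq.ι
  acyclic_left {a b : C₁} (i : a ⟶ b) {x y : C₂} (k : x ⟶ y) [Cofibration i] [Cofibration k]
    [WeakEquivalence i] (sq : F.PushoutObjObj i k) : WeakEquivalence sq.ι
  acyclic_right {a b : C₁} (i : a ⟶ b) {x y : C₂} (k : x ⟶ y) [Cofibration i] [Cofibration k]
    [WeakEquivalence k] (sq : F.PushoutObjObj i k) : WeakEquivalence sq.ι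

/-- The pullback-power axiom for a bifunctor `G : C₁ᵒᵖ × C₃ → C₂`: for a cofibration `i : a ⟶ b`
of `C₁` and a fibration `p : x ⟶ y` of `C₃`, the map
`G (b, x) ⟶ G (a, x) ×_{G (a, y)} G (b, y)` is a fibration, which is moreover acyclic
if `i` or `p` is. -/
structure PullbackPowerAxiom (G : C₁ᵒᵖ ⥤ C₃ ⥤ C₂) : Prop where
  fibration {a b : C₁} (i : a ⟶ b) {x y : C₃} (p : x ⟶ y) [Cofibration i] [Fibration p]
    (sq : G.PullbackObjObj i p) : Fibration sq.π
  acyclic_left {a b : C₁} (i : a ⟶ b) {x y : C₃} (p : x ⟶ y) [Cofibration i] [Fibration p]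
    [WeakEquivalence i] (sq : G.PullbackObjObj i p) : WeakEquivalence sq.π
  acyclic_right {a b : C₁} (i : a ⟶ b) {x y : C₃} (p : x ⟶ y) [Cofibration i] [Fibration p]
    [WeakEquivalence p] (sq : G.PullbackObjObj i p) : WeakEquivalence sq.π

end Axioms

/-! ### Monoidal model categories and enriched model categories -/

section Model

variable (V : Type u₁) [Category.{v₁} V] [ModelCategory V] [MonoidalCategory V]

/-- A (closed symmetric) monoidal category with a model structure is a (symmetric) monoidal model
category if it satisfies the pushout-product axiom and the unit axiom. (The closed and symmetric
structures are separate type classes.) -/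
structure IsMonoidalModelCategory : Prop where
  pushoutProduct : PushoutProductAxiom (curriedTensor V)
  unit {Q : V} [IsCofibrant Q] (q : Q ⟶ 𝟙_ V) [WeakEquivalence q] (x : V) [IsCofibrant x] :
    WeakEquivalence (x ◁ q ≫ (ρ_ x).hom)

variable (C : Type u₂) [Category.{v₂} C] [EnrichedOrdinaryCategory V C]

/-- Initial and terminal objects of the underlying category `C` are initial and terminal in the
enriched sense: the hom-objects out of the former and into the latter are terminal in `V`. -/
structure EnrichedInitialTerminal : Prop where
  initial {I : C} (hI : IsInitial I) (y : C) :
    Nonempty (IsTerminal (EnrichedCategory.Hom I y : V))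
  terminal {T : C} (hT : IsTerminal T) (x : C) :
    Nonempty (IsTerminal (EnrichedCategory.Hom x T : V))

variable [ModelCategory C]

/-- The axiom SM7 for the hom-objects bifunctor of a `V`-enriched category `C` whose underlying
category has a model structure. -/
def SM7 : Prop := PullbackPowerAxiom (eHomFunctor V C)

variable {V C}

/-- The `π₀` of mapping space axiom: for `x` cofibrant and `y` fibrant, the canonical map
`[x, y] ⟶ [𝟙, C(x, y)]`, which sends the class of `f : x ⟶ y` to the class of the corresponding
map `𝟙 ⟶ C(x, y)`, is a bijection. Here the hom-sets are those of the homotopy categories, i.e.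
of the targets of localization functors `γV` and `γC` at the weak equivalences. (As `x` is
cofibrant and `y` is fibrant, any map `γC x ⟶ γC y` is the image of a map `x ⟶ y`, so that the
condition on `Φ` below determines it.) -/
def PiZeroAxiom {HoV : Type u₃} [Category.{v₃} HoV] {HoC : Type u₄} [Category.{v₄} HoC]
    (γV : V ⥤ HoV) (γC : C ⥤ HoC) : Prop :=
  ∀ (x y : C) [IsCofibrant x] [IsFibrant y],
    ∃ Φ : (γC.obj x ⟶ γC.obj y) → (γV.obj (𝟙_ V) ⟶ γV.obj (EnrichedCategory.Hom x y)),
      (∀ f : x ⟶ y, Φ (γC.map f) = γV.map (eHomEquiv V f)) ∧ Function.Bijective Φ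

end Model

/-! ### Tensorings and cotensorings of enriched categories -/

section Tensoring

variable {W : Type u₁} [Category.{v₁} W] [MonoidalCategory W] [MonoidalClosed W]
  {D : Type u₂} [EnrichedCategory W D]

/-- The covariant action of `D` on the `W`-functor `y ↦ W(w, D(x, y))`: the map
`W(w, D(x, y)) ⊗ D(y, y') ⟶ W(w, D(x, y'))` induced by the composition of `D`. -/
def ihomAction (w : W) (x y y' : D) :
    (ihom w).obj (EnrichedCategory.Hom x y) ⊗ EnrichedCategory.Hom y y' ⟶
      (ihom w).obj (EnrichedCategory.Hom x y') :=
  MonoidalClosed.curry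
    ((α_ _ _ _).inv ≫ (ihom.ev w).app (EnrichedCategory.Hom x y) ▷ _ ≫ eComp W x y y')

/-- The contravariant action of `D` on the `W`-functor `x ↦ W(w, D(x, y))`: the map
`D(x', x) ⊗ W(w, D(x, y)) ⟶ W(w, D(x', y))` induced by the composition of `D`. -/
def ihomCoaction [BraidedCategory W] (w : W) (x' x y : D) :
    EnrichedCategory.Hom x' x ⊗ (ihom w).obj (EnrichedCategory.Hom x y) ⟶
      (ihom w).obj (EnrichedCategory.Hom x' y) :=
  MonoidalClosed.curry
    ((α_ _ _ _).inv ≫ (β_ w (EnrichedCategory.Hom x' x)).hom ▷ _ ≫ (α_ _ _ _).hom ≫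
      _ ◁ (ihom.ev w).app (EnrichedCategory.Hom x y) ≫ eComp W x' x y)

variable (W D)

/-- A tensoring of a `W`-category `D` over `W`: objects `x ⊗ w` with isomorphisms
`D(x ⊗ w, y) ≅ W(w, D(x, y))` in `W` which are `W`-natural in `y`. -/
structure Tensoring where
  /-- the tensor `x ⊗ w` -/
  obj : D → W → D
  /-- the isomorphism `D(x ⊗ w, y) ≅ W(w, D(x, y))` -/
  iso (w : W) (x y : D) :
    (EnrichedCategory.Hom (obj x w) y : W) ≅ (ihom w).obj (EnrichedCategory.Hom x y)
  natural (w : W) (x y y' : D) :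
    eComp W (obj x w) y y' ≫ (iso w x y').hom = (iso w x y).hom ▷ _ ≫ ihomAction w x y y'

/-- A cotensoring of a `W`-category `D` over `W`: objects `y ^ w` with isomorphisms
`D(x, y ^ w) ≅ W(w, D(x, y))` in `W` which are `W`-natural in `x`. -/
structure Cotensoring [BraidedCategory W] where
  /-- the cotensor `y ^ w` -/
  obj : D → W → D
  /-- the isomorphism `D(x, y ^ w) ≅ W(w, D(x, y))` -/
  iso (w : W) (x y : D) :
    (EnrichedCategory.Hom x (obj y w) : W) ≅ (ihom w).obj (EnrichedCategory.Hom x y)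
  natural (w : W) (x' x y : D) :
    eComp W x' x (obj y w) ≫ (iso w x' y).hom = _ ◁ (iso w x y).hom ≫ ihomCoaction w x' x y

end Tensoring

/-! ### Weak tensorings and weak cotensorings -/

section WeakTensoring

variable (V : Type u₁) [Category.{v₁} V] [ModelCategory V] [MonoidalCategory V] [MonoidalClosed V]
  (C : Type u₂) [Category.{v₂} C] [ModelCategory C] [EnrichedOrdinaryCategory V C]

/-- A weak tensoring of a `V`-enriched model category `C` over `V`. -/
structure WeakTensoring where
  /-- the bifunctor `(x, v) ↦ x ⊗ v` -/
  tensor : C ⥤ V ⥤ C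
  pushoutProduct : PushoutProductAxiom tensor
  /-- the structure map `C(x ⊗ v, y) ⟶ V(v, C(x, y))` -/
  φ (v : V) (x y : C) :
    (EnrichedCategory.Hom ((tensor.obj x).obj v) y : V) ⟶ (ihom v).obj (EnrichedCategory.Hom x y)
  /-- `φ` is natural in `v` -/
  natural_left {v v' : V} (g : v ⟶ v') (x y : C) :
    eHomWhiskerRight V ((tensor.obj x).map g) y ≫ φ v x y =
      φ v' x y ≫ (MonoidalClosed.pre g).app _
  /-- `φ` is natural in `x` -/
  natural_middle (v : V) {x x' : C} (f : x ⟶ x') (y : C) :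
    eHomWhiskerRight V ((tensor.map f).app v) y ≫ φ v x y =
      φ v x' y ≫ (ihom v).map (eHomWhiskerRight V f y)
  /-- `φ` is `V`-natural in `y` -/
  natural_right (v : V) (x y y' : C) :
    eComp V ((tensor.obj x).obj v) y y' ≫ φ v x y' = φ v x y ▷ _ ≫ ihomAction v x y y'
  weakEquivalence_φ (v : V) (x y : C) [IsCofibrant v] [IsCofibrant x] [IsFibrant y] :
    WeakEquivalence (φ v x y)
  /-- the natural map `x ⊗ 𝟙 ⟶ x` -/
  ρ : tensor.flip.obj (𝟙_ V) ⟶ 𝟭 C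
  unit (x y : C) :
    eHomWhiskerRight V (ρ.app x) y ≫ φ (𝟙_ V) x y =
      (MonoidalClosed.unitNatIso (C := V)).hom.app (EnrichedCategory.Hom x y)

/-- A weak cotensoring of a `V`-enriched model category `C` over `V`. -/
structure WeakCotensoring [BraidedCategory V] where
  /-- the bifunctor `(v, y) ↦ y ^ v` -/
  cotensor : Vᵒᵖ ⥤ C ⥤ C
  pullbackPower : PullbackPowerAxiom cotensor
  /-- the structure map `C(x, y ^ v) ⟶ V(v, C(x, y))` -/
  ψ (v : V) (x y : C) :
    (EnrichedCategory.Hom x ((cotensor.obj (op v)).obj y) : V) ⟶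
      (ihom v).obj (EnrichedCategory.Hom x y)
  /-- `ψ` is natural in `v` -/
  natural_left {v v' : V} (g : v ⟶ v') (x y : C) :
    eHomWhiskerLeft V x ((cotensor.map g.op).app y) ≫ ψ v x y =
      ψ v' x y ≫ (MonoidalClosed.pre g).app _
  /-- `ψ` is `V`-natural in `x` -/
  natural_middle (v : V) (x' x y : C) :
    eComp V x' x ((cotensor.obj (op v)).obj y) ≫ ψ v x' y =
      _ ◁ ψ v x y ≫ ihomCoaction v x' x y
  /-- `ψ` is natural in `y` -/
  natural_right (v : V) (x : C) {y y' : C} (f : y ⟶ y') :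
    eHomWhiskerLeft V x ((cotensor.obj (op v)).map f) ≫ ψ v x y' =
      ψ v x y ≫ (ihom v).map (eHomWhiskerLeft V x f)
  weakEquivalence_ψ (v : V) (x y : C) [IsCofibrant v] [IsCofibrant x] [IsFibrant y] :
    WeakEquivalence (ψ v x y)
  /-- the natural map `y ⟶ y ^ 𝟙` -/
  η : 𝟭 C ⟶ cotensor.obj (op (𝟙_ V))
  unit (x y : C) :
    eHomWhiskerLeft V x (η.app y) ≫ ψ (𝟙_ V) x y =
      (MonoidalClosed.unitNatIso (C := V)).hom.app (EnrichedCategory.Hom x y)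

end WeakTensoring

/-! ### Structures on homotopy categories -/

section Homotopy

variable {V : Type u₁} [Category.{v₁} V] [ModelCategory V] [MonoidalCategory V]
  {C : Type u₂} [Category.{v₂} C] [ModelCategory C] [EnrichedOrdinaryCategory V C]
  {HoV : Type u₃} [Category.{v₃} HoV] [MonoidalCategory HoV]
  {HoC : Type u₄} [Category.{v₄} HoC] [EnrichedOrdinaryCategory HoV HoC]

/-- A monoidal structure on the homotopy category of `V`, with a lax monoidal structure on the
localization functor `γ`, is the derived one if the unit comparison `𝟙 ⟶ γ 𝟙` is an isomorphism,
and the comparison `γ x ⊗ γ y ⟶ γ (x ⊗ y)` is an isomorphism for all cofibrant `x` and `y`, i.e.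
if the tensor product is the total left derived functor of the tensor product of `V`. -/
structure IsDerivedMonoidal (γ : V ⥤ HoV) [γ.LaxMonoidal] : Prop where
  isIso_ε : IsIso (Functor.LaxMonoidal.ε γ)
  isIso_μ (x y : V) [IsCofibrant x] [IsCofibrant y] : IsIso (Functor.LaxMonoidal.μ γ x y)

/-- The data which exhibits an enrichment of `HoC` in `HoV` as induced by the enrichment of `C`
in `V`, through the total right derived functor `γV C(Q x, R y)` of the hom-objects bifunctor:
there are maps `γV C(x, y) ⟶ HoC(γC x, γC y)`, which are compatible with composition, are
compatible with the action of `γC` on morphisms (in particular with identities), and are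
isomorphisms for `x` cofibrant and `y` fibrant. -/
structure DerivedEnrichment (γV : V ⥤ HoV) [γV.LaxMonoidal] (γC : C ⥤ HoC) where
  /-- the map `γV C(x, y) ⟶ HoC(γC x, γC y)` -/
  map (x y : C) :
    γV.obj (EnrichedCategory.Hom x y) ⟶ EnrichedCategory.Hom (γC.obj x) (γC.obj y)
  map_comp (x y z : C) :
    Functor.LaxMonoidal.μ γV _ _ ≫ γV.map (eComp V x y z) ≫ map x z =
      (map x y ⊗ₘ map y z) ≫ eComp HoV (γC.obj x) (γC.obj y) (γC.obj z)
  map_hom {x y : C} (f : x ⟶ y) :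
    Functor.LaxMonoidal.ε γV ≫ γV.map (eHomEquiv V f) ≫ map x y = eHomEquiv HoV (γC.map f)
  isIso_map (x y : C) [IsCofibrant x] [IsFibrant y] : IsIso (map x y)

variable [MonoidalClosed V] [MonoidalClosed HoV]

/-- The canonical comparison `γ V(v, z) ⟶ HoV(γ v, γ z)` between internal homs. -/
def ihomComparison (γ : V ⥤ HoV) [γ.LaxMonoidal] (v z : V) :
    γ.obj ((ihom v).obj z) ⟶ (ihom (γ.obj v)).obj (γ.obj z) :=
  MonoidalClosed.curry (Functor.LaxMonoidal.μ γ v _ ≫ γ.map ((ihom.ev v).app z))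

variable {γV : V ⥤ HoV} [γV.LaxMonoidal] {γC : C ⥤ HoC}

/-- The tensoring `t` of `HoC` over `HoV` is induced by the weak tensoring `T` of `C` over `V`:
for `x` and `v` cofibrant, the tensor of `γC x` and `γV v` is identified to `γC (x ⊗ v)` in such
a way that the isomorphism `HoC(γC x ⊗ γV v, γC y) ≅ HoV(γV v, HoC(γC x, γC y))` corresponds
to the image by `γV` of the structure map `C(x ⊗ v, y) ⟶ V(v, C(x, y))`. -/
def WeakTensoring.Induces (T : WeakTensoring V C) (E : DerivedEnrichment γV γC)
    (t : Tensoring HoV HoC) : Prop :=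
  ∀ (x : C) (v : V) [IsCofibrant x] [IsCofibrant v],
    ∃ e : t.obj (γC.obj x) (γV.obj v) ≅ γC.obj ((T.tensor.obj x).obj v), ∀ y : C,
      E.map ((T.tensor.obj x).obj v) y ≫ eHomWhiskerRight HoV e.hom (γC.obj y) ≫
          (t.iso (γV.obj v) (γC.obj x) (γC.obj y)).hom =
        γV.map (T.φ v x y) ≫ ihomComparison γV v _ ≫ (ihom (γV.obj v)).map (E.map x y)

/-- The cotensoring `t` of `HoC` over `HoV` is induced by the weak cotensoring `T` of `C`
over `V`: for `y` fibrant and `v` cofibrant, the cotensor of `γC y` and `γV v` is identified to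
`γC (y ^ v)` in such a way that the isomorphism
`HoC(γC x, (γC y) ^ (γV v)) ≅ HoV(γV v, HoC(γC x, γC y))` corresponds to the image by `γV` of the
structure map `C(x, y ^ v) ⟶ V(v, C(x, y))`. -/
def WeakCotensoring.Induces [BraidedCategory V] [BraidedCategory HoV]
    (T : WeakCotensoring V C) (E : DerivedEnrichment γV γC) (t : Cotensoring HoV HoC) : Prop :=
  ∀ (y : C) (v : V) [IsFibrant y] [IsCofibrant v],
    ∃ e : γC.obj ((T.cotensor.obj (op v)).obj y) ≅ t.obj (γC.obj y) (γV.obj v), ∀ x : C,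
      E.map x ((T.cotensor.obj (op v)).obj y) ≫ eHomWhiskerLeft HoV (γC.obj x) e.hom ≫
          (t.iso (γV.obj v) (γC.obj x) (γC.obj y)).hom =
        γV.map (T.ψ v x y) ≫ ihomComparison γV v _ ≫ (ihom (γV.obj v)).map (E.map x y)

end Homotopy

end EnrichedModel

end

noncomputable section

/-! Monoidal structure. The objects of `V` which are cofibrant or isomorphic to the unit are closed
under `⊗`, and by the unit axiom and Ken Brown's lemma tensoring them preserves weak equivalences
(`weakEquivalence_whiskerLeft_of_cofibrantOrUnit`). Localizing this full subcategory already gives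
`Ho(V)` (`isLocalization_ι_comp`), which thereby becomes symmetric monoidal. The lax structure of
`γ` on all of `V` comes from cofibrant resolutions. For `v` cofibrant and `z` fibrant, `γ V(v, z)`
represents the maps `γ v ⊗ W ⟶ γ z` (`bijective_evComparison`), which yields internal homs.

Enrichment. The objects `γ C(x, y)` are the homs of a `Ho(V)`-category on the objects of `C`. By the
`π₀` axiom, choosing bifibrant models embeds `Ho(C)` fully faithfully into its underlying category,
and the enrichment is pulled back along this embedding. The map `Γ` is the passage from `γ C(x, y)`
to `γ C(Qx, Qy)` and then to bifibrant models; SM7 makes the wrong-way maps invertible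
(`exists_derivedEnrichment`).

Tensoring. For `x` and `v` cofibrant, put `z = x ⊗ v`. The prescribed composites `γ C(z, y) ⟶
Ho(V)(γ v, Ho(C)(γ x, γ y))` respect the actions by composition, and they are invertible for `y`
fibrant. A Yoneda argument factors them through `Γ` and the natural map determined by a single
element `m`. The delicate point is that `z` is not known to be cofibrant, since the tensor bifunctor
need not preserve initial objects, so `Γ` is not known to be invertible at `z`. It is shown to be an
epimorphism (`epi_map`), and this forces the map given by `m` to be invertible
(`IsEquivariant.exists_iso`). Cotensorings are tensorings of the opposite category. -/

namespace EnrichedModel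

/-! ### Replacements representing the objects of a homotopy category -/

section ModelCategory

variable {M : Type u₁} [Category.{v₁} M] [ModelCategory M]
  {H : Type u₂} [Category.{v₂} H] (L : M ⥤ H) [L.IsLocalization (weakEquivalences M)]

lemma isIso_map_of_weakEquivalence {x y : M} (f : x ⟶ y) [WeakEquivalence f] : IsIso (L.map f) :=
  Localization.inverts L (weakEquivalences M) f (mem_weakEquivalences f)

lemma exists_fibrant_replacement (x : M) :
    ∃ (y : M) (j : x ⟶ y), IsFibrant y ∧ Cofibration j ∧ WeakEquivalence j :=
  ⟨_, FibrantObject.HoCat.iResolutionObj x, inferInstance, inferInstance, inferInstance⟩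

lemma exists_cofibrant_iso (X : H) : ∃ (x : M) (_ : IsCofibrant x), Nonempty (L.obj x ≅ X) := by
  have := Localization.essSurj L (weakEquivalences M)
  obtain ⟨x', hx', p, _, _⟩ := CofibrantObject.HoCat.exists_resolution (L.objPreimage X)
  have := isIso_map_of_weakEquivalence L p
  exact ⟨x', hx', ⟨asIso (L.map p) ≪≫ L.objObjPreimageIso X⟩⟩

lemma exists_fibrant_iso (X : H) : ∃ (x : M) (_ : IsFibrant x), Nonempty (L.obj x ≅ X) := by
  have := Localization.essSurj L (weakEquivalences M)
  obtain ⟨x', j, hx', _, _⟩ := exists_fibrant_replacement (L.objPreimage X)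
  have := isIso_map_of_weakEquivalence L j
  exact ⟨x', hx', ⟨(asIso (L.map j)).symm ≪≫ L.objObjPreimageIso X⟩⟩

lemma exists_bifibrant_iso (X : H) :
    ∃ (x : M) (_ : IsCofibrant x) (_ : IsFibrant x), Nonempty (L.obj x ≅ X) := by
  obtain ⟨x, _, ⟨e⟩⟩ := exists_fibrant_iso L X
  obtain ⟨x', hx', p, _, _⟩ := CofibrantObject.HoCat.exists_resolution x
  have := isIso_map_of_weakEquivalence L p
  exact ⟨x', hx', isFibrant_of_fibration p, ⟨asIso (L.map p) ≪≫ e⟩⟩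

lemma isCofibrant_of_iso {x y : M} (e : x ≅ y) [IsCofibrant x] : IsCofibrant y :=
  isCofibrant_of_cofibration e.hom

end ModelCategory

/-! ### Homotopical behaviour of the tensor product -/

section Monoidal

variable {V : Type u₁} [Category.{v₁} V] [MonoidalCategory V] [ModelCategory V]

lemma weakEquivalence_whiskerRight_iff [BraidedCategory V] (x : V) {a b : V} (f : a ⟶ b) :
    WeakEquivalence (f ▷ x) ↔ WeakEquivalence (x ◁ f) := by
  simp only [weakEquivalence_iff]
  exact (weakEquivalences V).arrow_mk_iso_iff (Arrow.isoMk (β_ a x) (β_ b x))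

section Closed

variable [SymmetricCategory V] [MonoidalClosed V]

instance preservesColimits_curriedTensor_flip_obj (x : V) :
    PreservesColimitsOfShape (Discrete PEmpty.{1}) ((curriedTensor V).flip.obj x) :=
  preservesColimitsOfShape_of_natIso (F := tensorLeft x)
    (NatIso.ofComponents (fun y ↦ β_ x y) (by simp))

instance preservesColimits_curriedTensor_obj (x : V) :
    PreservesColimitsOfShape (Discrete PEmpty.{1}) ((curriedTensor V).obj x) :=
  inferInstanceAs (PreservesColimitsOfShape (Discrete PEmpty.{1}) (tensorLeft x))

namespace IsMonoidalModelCategory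

/-- As `⊗` preserves initial objects in each variable, `x ◁ f` is the pushout-product of `∅ ⟶ x`
with `f`. -/
lemma cofibration_whiskerLeft (hV : IsMonoidalModelCategory V) (x : V)
    [IsCofibrant x] {a b : V} (f : a ⟶ b) [Cofibration f] :
    Cofibration (x ◁ f) :=
  hV.pushoutProduct.cofibration (initial.to x) f
    (Functor.PushoutObjObj.ofIsInitialLeft (curriedTensor V) _ _ initialIsInitial)

lemma isCofibrant_tensor (hV : IsMonoidalModelCategory V) (x y : V) [IsCofibrant x]
    [IsCofibrant y] : IsCofibrant (x ⊗ y) := by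
  have := hV.cofibration_whiskerLeft x (initial.to y)
  rwa [isCofibrant_iff_of_isInitial (x ◁ initial.to y)
    (IsInitial.isInitialObj (tensorLeft x) _ initialIsInitial)]

lemma weakEquivalence_whiskerLeft_of_cofibration (hV : IsMonoidalModelCategory V) (x : V)
    [IsCofibrant x] {a b : V} (f : a ⟶ b)
    [Cofibration f] [WeakEquivalence f] : WeakEquivalence (x ◁ f) :=
  hV.pushoutProduct.acyclic_right (initial.to x) f
    (Functor.PushoutObjObj.ofIsInitialLeft (curriedTensor V) _ _ initialIsInitial)

/-- Ken Brown's lemma: `f` factors as an acyclic cofibration followed by a retraction of another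
acyclic cofibration. -/
lemma weakEquivalence_whiskerLeft (hV : IsMonoidalModelCategory V) (x : V)
    [IsCofibrant x] {a b : V} (f : a ⟶ b)
    [IsCofibrant a] [IsCofibrant b] [WeakEquivalence f] : WeakEquivalence (x ◁ f) := by
  let h : CofibrantBrownFactorization f := Classical.arbitrary _
  have h₁ := hV.weakEquivalence_whiskerLeft_of_cofibration x h.i
  have h₂ := hV.weakEquivalence_whiskerLeft_of_cofibration x h.s
  have h₃ : WeakEquivalence (x ◁ h.p) :=
    weakEquivalence_of_precomp_of_fac (f := x ◁ h.s) (fg := 𝟙 _)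
      (by rw [← MonoidalCategory.whiskerLeft_comp, h.s_p, MonoidalCategory.whiskerLeft_id])
  rw [← h.fac, MonoidalCategory.whiskerLeft_comp]
  infer_instance

end IsMonoidalModelCategory

end Closed

variable (V) in
/-- The objects of a monoidal model category which are cofibrant or isomorphic to the unit. -/
def cofibrantOrUnit : ObjectProperty V := fun x ↦ IsCofibrant x ∨ Nonempty (x ≅ 𝟙_ V)

variable [SymmetricCategory V] [MonoidalClosed V]

namespace IsMonoidalModelCategory

/-- The unit need not be cofibrant, so cofibrant objects alone may fail to be a monoidal
subcategory; adjoining the unit repairs this. -/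
lemma isMonoidal_cofibrantOrUnit (hV : IsMonoidalModelCategory V) :
    (cofibrantOrUnit V).IsMonoidal where
  prop_unit := Or.inr ⟨Iso.refl _⟩
  prop_tensor x y := by
    rintro (hx | ⟨⟨ex⟩⟩) (hy | ⟨⟨ey⟩⟩)
    · exact Or.inl (hV.isCofibrant_tensor x y)
    · exact Or.inl (isCofibrant_of_iso ((ρ_ x).symm ≪≫ whiskerLeftIso x ey.symm))
    · exact Or.inl (isCofibrant_of_iso ((λ_ y).symm ≪≫ whiskerRightIso ex.symm y))
    · exact Or.inr ⟨whiskerLeftIso x ey ≪≫ ρ_ x ≪≫ ex⟩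

lemma weakEquivalence_whiskerLeft_of_cofibrantOrUnit (hV : IsMonoidalModelCategory V)
    {x a b : V} (hx : cofibrantOrUnit V x) (ha : cofibrantOrUnit V a) (hb : cofibrantOrUnit V b)
    (f : a ⟶ b) [WeakEquivalence f] :
    WeakEquivalence (x ◁ f) := by
  have h1 {Q : V} [IsCofibrant Q] (q : Q ⟶ 𝟙_ V) [WeakEquivalence q] (x : V) [IsCofibrant x] :
      WeakEquivalence (x ◁ q) := by
    have := hV.unit q x
    exact weakEquivalence_of_postcomp _ (ρ_ x).hom
  -- the case of a weak equivalence out of a cofibrant object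
  have key {x a b : V} [IsCofibrant x] [IsCofibrant a] (hb : cofibrantOrUnit V b) (f : a ⟶ b)
      [WeakEquivalence f] : WeakEquivalence (x ◁ f) := by
    obtain hb | ⟨⟨e⟩⟩ := hb
    · exact hV.weakEquivalence_whiskerLeft x f
    · have : WeakEquivalence (x ◁ (f ≫ e.hom)) := h1 (f ≫ e.hom) x
      rw [MonoidalCategory.whiskerLeft_comp] at this
      exact weakEquivalence_of_postcomp _ (x ◁ e.hom)
  obtain hx | ⟨⟨e⟩⟩ := hx
  -- Two-out-of-three for `p` and `p ≫ f`, both of which start at a cofibrant object.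
  · obtain ⟨a', _, p, _, _⟩ := CofibrantObject.HoCat.exists_resolution a
    have h₁ : WeakEquivalence (x ◁ p) := key ha p
    have h₂ : WeakEquivalence (x ◁ (p ≫ f)) := key hb (p ≫ f)
    rw [MonoidalCategory.whiskerLeft_comp] at h₂
    exact weakEquivalence_of_precomp (x ◁ p) _
  · rw [weakEquivalence_iff]
    refine ((weakEquivalences V).arrow_mk_iso_iff (Arrow.isoMk (whiskerRightIso e a ≪≫ λ_ a)
      (whiskerRightIso e b ≪≫ λ_ b) ?_)).2 (mem_weakEquivalences f)
    simp [whisker_exchange_assoc]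

end IsMonoidalModelCategory

end Monoidal

lemma comp_eq_of_squares {H : Type u₂} [Category.{v₂} H] {a b c d e f : H} {g : a ⟶ b} {i : b ⟶ c}
    {p : c ⟶ d} {i' : a ⟶ e} {q : e ⟶ c} {r : e ⟶ f} {k : f ⟶ d} (h₁ : g ≫ i = i' ≫ q)
    (h₂ : q ≫ p = r ≫ k) : g ≫ i ≫ p = (i' ≫ r) ≫ k := by
  rw [reassoc_of% h₁, h₂, assoc]

/-! ### Localization of full subcategories containing the cofibrant objects -/

section Localization

variable {M : Type u₁} [Category.{v₁} M] [ModelCategory M]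
  {H : Type u₂} [Category.{v₂} H] (L : M ⥤ H) [L.IsLocalization (weakEquivalences M)]
  (P : ObjectProperty M) (hP : cofibrantObjects M ≤ P)

variable {P} in
include hP in
lemma prop_of_isCofibrant (x : M) [hx : IsCofibrant x] : P x := hP x hx

variable {P} in
/-- The chosen cofibrant replacement, as an object of a full subcategory which contains the
cofibrant objects. -/
abbrev subResolutionObj (x : M) : P.FullSubcategory :=
  ⟨CofibrantObject.HoCat.resolutionObj x, prop_of_isCofibrant hP _⟩

/-- The weak equivalences of a full subcategory of a model category. -/
abbrev subWeakEquivalences : MorphismProperty P.FullSubcategory :=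
  (weakEquivalences M).inverseImage P.ι

variable {P} in
/-- The functor from the homotopy category of cofibrant objects to the localization of a full
subcategory which contains the cofibrant objects. -/
def hoCatToSubLocalization :
    CofibrantObject.HoCat M ⥤ (subWeakEquivalences P).Localization :=
  CategoryTheory.Quotient.lift _ (ObjectProperty.ιOfLE hP ⋙ (subWeakEquivalences P).Q)
    (fun _ _ _ _ h ↦ (CofibrantObject.factorsThroughLocalization M h).map_eq_of_isInvertedBy _
      (fun _ _ f hf ↦ Localization.inverts (subWeakEquivalences P).Q (subWeakEquivalences P)
        ((ObjectProperty.ιOfLE hP).map f) hf))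

variable {P} in
/-- A cofibrant replacement functor with values in the localization of a full subcategory which
contains the cofibrant objects. -/
def subResolution : M ⥤ (subWeakEquivalences P).Localization :=
  CofibrantObject.HoCat.resolution ⋙ hoCatToSubLocalization hP

include hP in
/-- A localization functor of a model category restricts to a localization functor on any full
subcategory which contains the cofibrant objects. -/
lemma isLocalization_ι_comp : (P.ι ⋙ L).IsLocalization (subWeakEquivalences P) := by
  let W' := subWeakEquivalences P
  let L' := W'.Q
  have hL : W'.IsInvertedBy (P.ι ⋙ L) := fun x y f hf ↦
    Localization.inverts L (weakEquivalences M) _ hf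
  let G : W'.Localization ⥤ H := Localization.lift (P.ι ⋙ L) hL L'
  let eG : L' ⋙ G ≅ P.ι ⋙ L := Localization.fac _ _ _
  -- Cofibrant resolution is functorial only up to homotopy, hence takes values in the localization;
  -- it induces the quasi-inverse `G'` of `G`.
  let R : M ⥤ W'.Localization := subResolution hP
  have hR : (weakEquivalences M).IsInvertedBy R := fun x y f hf ↦
    Localization.inverts L' W' (X := subResolutionObj hP x) (Y := subResolutionObj hP y)
      (P.homMk (CofibrantObject.HoCat.resolutionMap f)) (by
      rw [← weakEquivalence_iff] at hf
      rw [← CofibrantObject.HoCat.weakEquivalence_resolutionMap_iff] at hf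
      exact mem_weakEquivalences (CofibrantObject.HoCat.resolutionMap f))
  let G' : H ⥤ W'.Localization := Localization.lift R hR L
  let eG' : L ⋙ G' ≅ R := Localization.fac _ _ _
  -- Both `e₁` and `e₂` are induced by the resolution maps `Qx ⟶ x`, which become invertible.
  let e₁ : P.ι ⋙ R ≅ L' := NatIso.ofComponents
    (fun x ↦ Localization.isoOfHom L' W'
      (X := subResolutionObj hP x.obj)
      (P.homMk (CofibrantObject.HoCat.pResolutionObj x.obj))
      (mem_weakEquivalences (CofibrantObject.HoCat.pResolutionObj x.obj)))
    (fun {x y} f ↦ by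
      have : P.homMk (X := subResolutionObj hP x.obj) (Y := subResolutionObj hP y.obj)
            (CofibrantObject.HoCat.resolutionMap f.hom) ≫
          P.homMk (CofibrantObject.HoCat.pResolutionObj y.obj) =
          P.homMk (CofibrantObject.HoCat.pResolutionObj x.obj) ≫ f := by
        ext
        exact CofibrantObject.HoCat.resolutionMap_fac f.hom
      exact (L'.map_comp _ _).symm.trans ((L'.congr_map this).trans (L'.map_comp _ _)))
  let e₂ : R ⋙ G ≅ L := NatIso.ofComponents
    (fun x ↦ eG.app (subResolutionObj hP x) ≪≫
      Localization.isoOfHom L (weakEquivalences M) (CofibrantObject.HoCat.pResolutionObj x)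
        (mem_weakEquivalences _))
    (fun {x y} f ↦ by
      have := eG.hom.naturality (P.homMk (X := subResolutionObj hP x)
        (Y := subResolutionObj hP y) (CofibrantObject.HoCat.resolutionMap f))
      have h' := L.congr_map (CofibrantObject.HoCat.resolutionMap_fac f)
      rw [L.map_comp, L.map_comp] at h'
      exact comp_eq_of_squares this h')
  let _ : Localization.Lifting L' W' L' (G ⋙ G') :=
    ⟨(Functor.associator _ _ _).symm ≪≫ Functor.isoWhiskerRight eG G' ≪≫
      Functor.associator _ _ _ ≪≫ Functor.isoWhiskerLeft _ eG' ≪≫ e₁⟩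
  let _ : Localization.Lifting L (weakEquivalences M) L (G' ⋙ G) :=
    ⟨(Functor.associator _ _ _).symm ≪≫ Functor.isoWhiskerRight eG' G ≪≫ e₂⟩
  let E : W'.Localization ≌ H := CategoryTheory.Equivalence.mk G G'
    (Localization.liftNatIso L' W' L' L' _ _ (Iso.refl _))
    (Localization.liftNatIso L (weakEquivalences M) L L _ _ (Iso.refl _))
  exact Functor.IsLocalization.of_equivalence_target L' W' (P.ι ⋙ L) E eG

end Localization

/-! ### Extending a monoidal structure from resolutions to a lax one on the whole category -/

section LaxMonoidal

lemma sub_μ_natural {M : Type u₁} [Category.{v₁} M] [MonoidalCategory M]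
    {H : Type u₂} [Category.{v₂} H] [MonoidalCategory H] (L : M ⥤ H)
    {P : ObjectProperty M} [P.IsMonoidal] [(P.ι ⋙ L).LaxMonoidal]
    {a b a' b' : P.FullSubcategory} (f : a.obj ⟶ a'.obj) (g : b.obj ⟶ b'.obj) :
    (L.map f ⊗ₘ L.map g) ≫ Functor.LaxMonoidal.μ (P.ι ⋙ L) a' b' =
      Functor.LaxMonoidal.μ (P.ι ⋙ L) a b ≫ L.map (f ⊗ₘ g) :=
  Functor.LaxMonoidal.μ_natural (P.ι ⋙ L) (P.homMk f) (P.homMk g)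

variable {M : Type u₁} [Category.{v₁} M] [MonoidalCategory M] [ModelCategory M]
  {H : Type u₂} [Category.{v₂} H] [MonoidalCategory H]
  (L : M ⥤ H) [L.IsLocalization (weakEquivalences M)]
  {P : ObjectProperty M} [P.IsMonoidal] (hP : cofibrantObjects M ≤ P) [(P.ι ⋙ L).Monoidal]

open CofibrantObject.HoCat Functor.LaxMonoidal

instance isIso_map_pResolutionObj (x : M) : IsIso (L.map (pResolutionObj x)) :=
  isIso_map_of_weakEquivalence L _

/-- The comparison map `L x ⊗ L y ⟶ L (x ⊗ y)` obtained by cofibrant replacement. -/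
def derivedμ (x y : M) : L.obj x ⊗ L.obj y ⟶ L.obj (x ⊗ y) :=
  (inv (L.map (pResolutionObj x)) ⊗ₘ inv (L.map (pResolutionObj y))) ≫
    μ (P.ι ⋙ L) (subResolutionObj hP x) (subResolutionObj hP y) ≫
      L.map (pResolutionObj x ⊗ₘ pResolutionObj y)

lemma map_pResolutionObj_derivedμ (x y : M) :
    (L.map (pResolutionObj x) ⊗ₘ L.map (pResolutionObj y)) ≫ derivedμ L hP x y =
      μ (P.ι ⋙ L) (subResolutionObj hP x) (subResolutionObj hP y) ≫
        L.map (pResolutionObj x ⊗ₘ pResolutionObj y) := by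
  simp [derivedμ]

/-- Independence of the resolution: any maps from objects of `P` compute `derivedμ`. This holds
because `f` and `g` lift to the chosen resolutions, and `μ` is natural on `P`. The coherence laws
below reduce to those on `P` through this formula. -/
lemma tensorHom_derivedμ {a b : P.FullSubcategory} {x y : M} (f : a.obj ⟶ x) (g : b.obj ⟶ y) :
    (L.map f ⊗ₘ L.map g) ≫ derivedμ L hP x y = μ (P.ι ⋙ L) a b ≫ L.map (f ⊗ₘ g) := by
  have h₁ := sub_μ_natural L (a := subResolutionObj hP a.obj) (b := subResolutionObj hP b.obj)
    (a' := a) (b' := b) (pResolutionObj a.obj) (pResolutionObj b.obj)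
  have h₂ := sub_μ_natural L (a := subResolutionObj hP a.obj) (b := subResolutionObj hP b.obj)
    (a' := subResolutionObj hP x) (b' := subResolutionObj hP y) (resolutionMap f) (resolutionMap g)
  rw [← cancel_epi (L.map (pResolutionObj a.obj) ⊗ₘ L.map (pResolutionObj b.obj)),
    reassoc_of% h₁, tensorHom_comp_tensorHom_assoc, ← L.map_comp, ← L.map_comp,
    ← resolutionMap_fac, ← resolutionMap_fac, L.map_comp, L.map_comp,
    ← tensorHom_comp_tensorHom_assoc, map_pResolutionObj_derivedμ, reassoc_of% h₂,
    ← L.map_comp, ← L.map_comp, tensorHom_comp_tensorHom, tensorHom_comp_tensorHom,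
    resolutionMap_fac, resolutionMap_fac]

lemma derivedμ_eq (a b : P.FullSubcategory) :
    derivedμ L hP a.obj b.obj = μ (P.ι ⋙ L) a b := by
  simpa using tensorHom_derivedμ L hP (𝟙 a.obj) (𝟙 b.obj)

lemma derivedμ_natural {x y x' y' : M} (f : x ⟶ x') (g : y ⟶ y') :
    (L.map f ⊗ₘ L.map g) ≫ derivedμ L hP x' y' = derivedμ L hP x y ≫ L.map (f ⊗ₘ g) := by
  rw [← cancel_epi (L.map (pResolutionObj x) ⊗ₘ L.map (pResolutionObj y)),
    tensorHom_comp_tensorHom_assoc, ← L.map_comp, ← L.map_comp,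
    tensorHom_derivedμ L hP (a := subResolutionObj hP x) (b := subResolutionObj hP y),
    reassoc_of% map_pResolutionObj_derivedμ, ← L.map_comp, tensorHom_comp_tensorHom]

lemma derivedμ_associativity (x y z : M) :
    derivedμ L hP x y ▷ L.obj z ≫ derivedμ L hP (x ⊗ y) z ≫ L.map (α_ x y z).hom =
      (α_ (L.obj x) (L.obj y) (L.obj z)).hom ≫ L.obj x ◁ derivedμ L hP y z ≫
        derivedμ L hP x (y ⊗ z) := by
  let a := subResolutionObj hP x
  let b := subResolutionObj hP y
  let c := subResolutionObj hP z
  have h := associativity (P.ι ⋙ L) a b c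
  -- `a ⊗ b` lies in `P` and may serve in place of a resolution of `x ⊗ y`, even though its map to
  -- `x ⊗ y` need not be a weak equivalence.
  have h₁ := tensorHom_derivedμ L hP (a := a ⊗ b) (b := c) (pResolutionObj x ⊗ₘ pResolutionObj y)
    (pResolutionObj z)
  have h₂ := tensorHom_derivedμ L hP (a := a) (b := b ⊗ c) (pResolutionObj x)
    (pResolutionObj y ⊗ₘ pResolutionObj z)
  rw [← cancel_epi ((L.map (pResolutionObj x) ⊗ₘ L.map (pResolutionObj y)) ⊗ₘ
    L.map (pResolutionObj z))]
  have e₁ : ((L.map (pResolutionObj x) ⊗ₘ L.map (pResolutionObj y)) ⊗ₘ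
      L.map (pResolutionObj z)) ≫ derivedμ L hP x y ▷ L.obj z =
      (μ (P.ι ⋙ L) a b ▷ L.obj c.obj) ≫ (L.map (pResolutionObj x ⊗ₘ pResolutionObj y) ⊗ₘ
        L.map (pResolutionObj z)) := by
    rw [← tensorHom_id, tensorHom_comp_tensorHom, map_pResolutionObj_derivedμ, ← tensorHom_id,
      tensorHom_comp_tensorHom, comp_id]
    erw [id_comp]
  have e₂ : (L.map (pResolutionObj x) ⊗ₘ L.map (pResolutionObj y) ⊗ₘ
      L.map (pResolutionObj z)) ≫ L.obj x ◁ derivedμ L hP y z =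
      (L.obj a.obj ◁ μ (P.ι ⋙ L) b c) ≫ (L.map (pResolutionObj x) ⊗ₘ
        L.map (pResolutionObj y ⊗ₘ pResolutionObj z)) := by
    rw [← id_tensorHom, tensorHom_comp_tensorHom, map_pResolutionObj_derivedμ, ← id_tensorHom,
      tensorHom_comp_tensorHom, comp_id]
    erw [id_comp]
  rw [reassoc_of% e₁, reassoc_of% h₁, associator_naturality_assoc, reassoc_of% e₂, h₂,
    ← L.map_comp, associator_naturality, L.map_comp]
  exact (reassoc_of% h) _

variable (P) in
/-- The unit comparison map `𝟙 ⟶ L 𝟙`. -/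
def derivedε : 𝟙_ H ⟶ L.obj (𝟙_ M) := ε (P.ι ⋙ L)

lemma derivedμ_left_unitality (x : M) :
    (λ_ (L.obj x)).hom = derivedε L P ▷ L.obj x ≫ derivedμ L hP (𝟙_ M) x ≫ L.map (λ_ x).hom := by
  let a := subResolutionObj hP x
  have h := left_unitality (P.ι ⋙ L) a
  have h₁ : (𝟙 (L.obj (𝟙_ M)) ⊗ₘ L.map (pResolutionObj x)) ≫
      derivedμ L hP (𝟙_ M) x ≫ L.map (λ_ x).hom =
        μ (P.ι ⋙ L) (𝟙_ _) a ≫ L.map (λ_ a.obj).hom ≫ L.map (pResolutionObj x) := by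
    have h₂ := tensorHom_derivedμ L hP (a := 𝟙_ _) (b := a) (𝟙 (𝟙_ M)) (pResolutionObj x)
    have h₃ : (𝟙 (𝟙_ M) ⊗ₘ pResolutionObj x) ≫ (λ_ x).hom = (λ_ a.obj).hom ≫ pResolutionObj x := by
      simp [a]
    erw [L.map_id] at h₂
    rw [← L.map_comp, ← h₃, L.map_comp]
    exact (reassoc_of% h₂) _
  rw [← cancel_epi (𝟙_ H ◁ L.map (pResolutionObj x)), leftUnitor_naturality,
    whisker_exchange_assoc, ← id_tensorHom, h₁]
  exact (h =≫ L.map (pResolutionObj x)).trans (by simp only [assoc]; rfl)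

lemma derivedμ_right_unitality (x : M) :
    (ρ_ (L.obj x)).hom = L.obj x ◁ derivedε L P ≫ derivedμ L hP x (𝟙_ M) ≫ L.map (ρ_ x).hom := by
  let a := subResolutionObj hP x
  have h := right_unitality (P.ι ⋙ L) a
  have h₁ : (L.map (pResolutionObj x) ⊗ₘ 𝟙 (L.obj (𝟙_ M))) ≫
      derivedμ L hP x (𝟙_ M) ≫ L.map (ρ_ x).hom =
        μ (P.ι ⋙ L) a (𝟙_ _) ≫ L.map (ρ_ a.obj).hom ≫ L.map (pResolutionObj x) := by
    have h₂ := tensorHom_derivedμ L hP (a := a) (b := 𝟙_ _) (pResolutionObj x) (𝟙 (𝟙_ M))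
    have h₃ : (pResolutionObj x ⊗ₘ 𝟙 (𝟙_ M)) ≫ (ρ_ x).hom = (ρ_ a.obj).hom ≫ pResolutionObj x := by
      simp [a]
    erw [L.map_id] at h₂
    rw [← L.map_comp, ← h₃, L.map_comp]
    exact (reassoc_of% h₂) _
  rw [← cancel_epi (L.map (pResolutionObj x) ▷ 𝟙_ H), rightUnitor_naturality,
    ← whisker_exchange_assoc, ← tensorHom_id, h₁]
  exact (h =≫ L.map (pResolutionObj x)).trans (by simp only [assoc]; rfl)

/-- If the restriction of a localization functor of a model category to a monoidal full
subcategory which contains the cofibrant objects is monoidal, then the localization functor is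
lax monoidal. -/
@[reducible]
def derivedLaxMonoidal : L.LaxMonoidal where
  ε := derivedε L P
  μ := derivedμ L hP
  μ_natural_left f z := by simpa using derivedμ_natural L hP f (𝟙 z)
  μ_natural_right z f := by simpa using derivedμ_natural L hP (𝟙 z) f
  associativity := derivedμ_associativity L hP
  left_unitality := derivedμ_left_unitality L hP
  right_unitality := derivedμ_right_unitality L hP

end LaxMonoidal

section LaxBraided

variable {M : Type u₁} [Category.{v₁} M] [MonoidalCategory M] [BraidedCategory M] [ModelCategory M]
  {H : Type u₂} [Category.{v₂} H] [MonoidalCategory H] [BraidedCategory H]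
  (L : M ⥤ H) [L.IsLocalization (weakEquivalences M)]
  {P : ObjectProperty M} [P.IsMonoidal] (hP : cofibrantObjects M ≤ P) [(P.ι ⋙ L).Braided]

open CofibrantObject.HoCat Functor.LaxMonoidal

lemma derivedμ_braided (x y : M) :
    derivedμ L hP x y ≫ L.map (β_ x y).hom = (β_ (L.obj x) (L.obj y)).hom ≫ derivedμ L hP y x := by
  have h := Functor.LaxBraided.braided (F := P.ι ⋙ L) (subResolutionObj hP x)
    (subResolutionObj hP y)
  rw [← cancel_epi (L.map (pResolutionObj x) ⊗ₘ L.map (pResolutionObj y)),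
    reassoc_of% map_pResolutionObj_derivedμ, BraidedCategory.braiding_naturality_assoc,
    map_pResolutionObj_derivedμ, ← L.map_comp, BraidedCategory.braiding_naturality, L.map_comp]
  exact (reassoc_of% h) _

/-- The braided version of `derivedLaxMonoidal`. -/
@[reducible]
def derivedLaxBraided : L.LaxBraided where
  __ := derivedLaxMonoidal L hP
  braided := derivedμ_braided L hP

lemma derivedLaxBraided_isDerivedMonoidal :
    letI := derivedLaxBraided L hP
    IsDerivedMonoidal L :=
  letI := derivedLaxBraided L hP
  { isIso_ε := inferInstanceAs (IsIso (Functor.Monoidal.εIso (P.ι ⋙ L)).hom)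
    isIso_μ x y _ _ := by
      have : IsIso (derivedμ L hP x y) := by
        rw [derivedμ_eq L hP ⟨x, prop_of_isCofibrant hP x⟩ ⟨y, prop_of_isCofibrant hP y⟩]
        infer_instance
      exact this }

end LaxBraided

/-! ### Derived internal homs -/

section InternalHom

variable {V : Type u₁} [Category.{v₁} V] [MonoidalCategory V] [ModelCategory V]
  [SymmetricCategory V] [MonoidalClosed V]

namespace IsMonoidalModelCategory

/-- By adjunction: the right lifting property of `V(v, p)` against cofibrations `i` is that of `p`
against `v ◁ i`. -/
lemma weakEquivalence_ihom_map_of_fibration (hV : IsMonoidalModelCategory V) (v : V)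
    [IsCofibrant v] {x y : V} (p : x ⟶ y) [Fibration p] [WeakEquivalence p] :
    WeakEquivalence ((ihom v).map p) := by
  have : trivialFibrations V ((ihom v).map p) := by
    rw [← cofibrations_rlp]
    intro a b i hi
    rw [← cofibration_iff] at hi
    rw [← (ihom.adjunction v).hasLiftingProperty_iff]
    have : Cofibration ((tensorLeft v).map i) := hV.cofibration_whiskerLeft v i
    infer_instance
  rw [weakEquivalence_iff]
  exact this.2

lemma isFibrant_ihom (hV : IsMonoidalModelCategory V) (v z : V) [IsCofibrant v] [IsFibrant z] :
    IsFibrant ((ihom v).obj z) := by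
  have : Fibration ((ihom v).map (terminal.from z)) := by
    rw [fibration_iff, ← trivialCofibrations_rlp]
    intro a b i hi
    obtain ⟨_, _⟩ := (mem_trivialCofibrations_iff i).1 hi
    rw [← (ihom.adjunction v).hasLiftingProperty_iff]
    have : Cofibration ((tensorLeft v).map i) := hV.cofibration_whiskerLeft v i
    have : WeakEquivalence ((tensorLeft v).map i) :=
      hV.weakEquivalence_whiskerLeft_of_cofibration v i
    infer_instance
  rwa [isFibrant_iff_of_isTerminal ((ihom v).map (terminal.from z))
    (IsTerminal.isTerminalObj (ihom v) _ terminalIsTerminal)]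

lemma weakEquivalence_ihom_map (hV : IsMonoidalModelCategory V) (v : V) [IsCofibrant v] {x y : V}
    (f : x ⟶ y) [IsFibrant x] [IsFibrant y] [WeakEquivalence f] :
    WeakEquivalence ((ihom v).map f) := by
  let h : FibrantBrownFactorization f := Classical.arbitrary _
  have h₁ := hV.weakEquivalence_ihom_map_of_fibration v h.p
  have h₂ := hV.weakEquivalence_ihom_map_of_fibration v h.r
  have h₃ : WeakEquivalence ((ihom v).map h.i) :=
    weakEquivalence_of_postcomp_of_fac (g := (ihom v).map h.r) (fg := 𝟙 _)
      (by rw [← Functor.map_comp, h.i_r, CategoryTheory.Functor.map_id])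
  rw [← h.fac, Functor.map_comp]
  infer_instance

end IsMonoidalModelCategory

end InternalHom

section Comparison

variable {V : Type u₁} [Category.{v₁} V] [MonoidalCategory V] [MonoidalClosed V]
variable {H : Type u₂} [Category.{v₂} H] [MonoidalCategory H] (γ : V ⥤ H) [γ.LaxMonoidal]

open Functor.LaxMonoidal

/-- The comparison map `γ v ⊗ γ V(v, z) ⟶ γ z`. -/
def evComparison (v z : V) : γ.obj v ⊗ γ.obj ((ihom v).obj z) ⟶ γ.obj z :=
  μ γ v _ ≫ γ.map ((ihom.ev v).app z)

lemma whiskerLeft_map_evComparison {v w z : V} (g : w ⟶ (ihom v).obj z) :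
    γ.obj v ◁ γ.map g ≫ evComparison γ v z = μ γ v w ≫ γ.map (MonoidalClosed.uncurry g) := by
  rw [evComparison, μ_natural_right_assoc, ← γ.map_comp, MonoidalClosed.uncurry_eq]

end Comparison

section Closed

variable {V : Type u₁} [Category.{v₁} V] [MonoidalCategory V] [ModelCategory V]
  [SymmetricCategory V] [MonoidalClosed V]
  {H : Type u₂} [Category.{v₂} H] [MonoidalCategory H] (γ : V ⥤ H) [γ.LaxMonoidal]
  [γ.IsLocalization (weakEquivalences V)]

open Functor.LaxMonoidal

/-- Maps `W ⟶ γ V(v, z)` correspond to maps `γ v ⊗ W ⟶ γ z`, for `v` cofibrant and `z` fibrant. -/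
lemma bijective_evComparison (hV : IsMonoidalModelCategory V) (hγ : IsDerivedMonoidal γ)
    (v z : V) [IsCofibrant v] [IsFibrant z] (W : H) :
    Function.Bijective (fun h : W ⟶ γ.obj ((ihom v).obj z) ↦ γ.obj v ◁ h ≫ evComparison γ v z) := by
  have := hV.isFibrant_ihom v z
  -- With `W = γ w`, all maps in question come from `V`, as `w` and `v ⊗ w` are cofibrant while
  -- `V(v, z)` and `z` are fibrant; on representatives the map is uncurrying.
  obtain ⟨w, _, ⟨e⟩⟩ := exists_cofibrant_iso γ W
  have := hV.isCofibrant_tensor v w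
  have := hγ.isIso_μ v w
  have surj (h : γ.obj w ⟶ γ.obj ((ihom v).obj z)) : ∃ g, γ.map g = h :=
    map_surjective_of_isLocalization γ _ _ h
  constructor
  · intro h h' hh'
    obtain ⟨g, hg⟩ := surj (e.hom ≫ h)
    obtain ⟨g', hg'⟩ := surj (e.hom ≫ h')
    suffices γ.map g = γ.map g' by
      rw [← cancel_epi e.hom, ← hg, ← hg', this]
    replace hh' := γ.obj v ◁ e.hom ≫= hh'
    dsimp at hh'
    rw [← MonoidalCategory.whiskerLeft_comp_assoc, ← MonoidalCategory.whiskerLeft_comp_assoc,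
      ← hg, ← hg', whiskerLeft_map_evComparison, whiskerLeft_map_evComparison, cancel_epi,
      ← RightHomotopyRel.iff_map_eq] at hh'
    -- A right homotopy through a path object `P` of `z` curries to one through `V(v, P)`. The maps
    -- `V(v, p₀)` and `V(v, p₁)` have the same image under `γ`, being retractions of the invertible
    -- `γ V(v, ι)`.
    obtain ⟨P, _, ⟨k⟩⟩ := hh'.exists_good_pathObject
    have : IsFibrant P.P := isFibrant_of_fibration P.p₀
    have := hV.weakEquivalence_ihom_map v P.ι
    have := isIso_map_of_weakEquivalence γ ((ihom v).map P.ι)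
    have h₀ : g = MonoidalClosed.curry k.h ≫ (ihom v).map P.p₀ := by
      rw [← MonoidalClosed.curry_natural_right, k.h₀, MonoidalClosed.curry_uncurry]
    have h₁ : g' = MonoidalClosed.curry k.h ≫ (ihom v).map P.p₁ := by
      rw [← MonoidalClosed.curry_natural_right, k.h₁, MonoidalClosed.curry_uncurry]
    generalize MonoidalClosed.curry k.h = l at h₀ h₁
    refine (congrArg γ.map h₀).trans (Eq.trans ?_ (congrArg γ.map h₁).symm)
    rw [γ.map_comp, γ.map_comp]
    congr 1
    rw [← cancel_epi (γ.map ((ihom v).map P.ι)), ← γ.map_comp, ← γ.map_comp,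
      ← Functor.map_comp, ← Functor.map_comp, P.ι_p₀, P.ι_p₁]
  · intro k
    obtain ⟨f, hf⟩ := map_surjective_of_isLocalization γ _ _
      (inv (μ γ v w) ≫ γ.obj v ◁ e.hom ≫ k)
    refine ⟨e.inv ≫ γ.map (MonoidalClosed.curry f), ?_⟩
    dsimp
    rw [MonoidalCategory.whiskerLeft_comp, assoc, whiskerLeft_map_evComparison,
      MonoidalClosed.uncurry_curry, hf, IsIso.hom_inv_id_assoc, whiskerLeft_inv_hom_assoc]

/-- By the Yoneda lemma: `γ V(v, z)` and the internal hom of `H` represent the same functor. -/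
lemma isIso_ihomComparison [MonoidalClosed H] (hV : IsMonoidalModelCategory V)
    (hγ : IsDerivedMonoidal γ) (v z : V) [IsCofibrant v] [IsFibrant z] :
    IsIso (ihomComparison γ v z) := by
  rw [isIso_iff_yoneda_map_bijective]
  intro W
  have := (((ihom.adjunction (γ.obj v)).homEquiv W (γ.obj z)).bijective).comp
    (bijective_evComparison γ hV hγ v z W)
  convert this using 1
  ext h
  exact (MonoidalClosed.curry_natural_left h (evComparison γ v z)).symm

/-- The derived tensor product is closed. -/
@[reducible]
def derivedMonoidalClosed (hV : IsMonoidalModelCategory V) (hγ : IsDerivedMonoidal γ) :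
    MonoidalClosed H where
  closed X := by
    let v := (exists_cofibrant_iso γ X).choose
    have : IsCofibrant v := (exists_cofibrant_iso γ X).choose_spec.choose
    let e : γ.obj v ≅ X := (exists_cofibrant_iso γ X).choose_spec.choose_spec.some
    let z (Y : H) := (exists_fibrant_iso γ Y).choose
    have (Y : H) : IsFibrant (z Y) := (exists_fibrant_iso γ Y).choose_spec.choose
    let e' (Y : H) : γ.obj (z Y) ≅ Y := (exists_fibrant_iso γ Y).choose_spec.choose_spec.some
    let E (W Y : H) : (X ⊗ W ⟶ Y) ≃ (W ⟶ γ.obj ((ihom v).obj (z Y))) :=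
      ((Iso.homCongr (whiskerRightIso e W) (e' Y)).symm.trans
        (Equiv.ofBijective _ (bijective_evComparison γ hV hγ v (z Y) W)).symm)
    exact
      { rightAdj := Adjunction.rightAdjointOfEquiv (F := tensorLeft X) E (fun W' W Y f g ↦ by
          dsimp [E]
          rw [Equiv.symm_apply_eq, Equiv.ofBijective_apply, MonoidalCategory.whiskerLeft_comp,
            assoc]
          erw [Equiv.ofBijective_apply_symm_apply _
            (bijective_evComparison γ hV hγ v (z Y) W)]
          simp [Iso.homCongr, whisker_exchange_assoc])
        adj := Adjunction.adjunctionOfEquivRight _ _ }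

end Closed

/-! ### Existence of the derived closed symmetric monoidal structure -/

section Existence

variable {V : Type u₁} [Category.{v₁} V] [MonoidalCategory V] [ModelCategory V]
  [SymmetricCategory V] [MonoidalClosed V]

/-- Keeps the structures as explicit data, so that those of `LocalizedMonoidal`, a type synonym of
the homotopy category, can be transferred to the latter. -/
lemma exists_laxBraided {H : Type u₂} [Category.{v₂} H] [m : MonoidalCategory H]
    [s : SymmetricCategory H] (γ : V ⥤ H) [hL : γ.IsLocalization (weakEquivalences V)]
    (hV : IsMonoidalModelCategory V) {P : ObjectProperty V} [P.IsMonoidal]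
    (hP : cofibrantObjects V ≤ P) [hB : (P.ι ⋙ γ).Braided] :
    ∃ (_ : MonoidalCategory H) (_ : SymmetricCategory H) (_ : MonoidalClosed H)
      (_ : γ.LaxBraided), IsDerivedMonoidal γ := by
  let l : γ.LaxBraided := derivedLaxBraided γ hP
  have hγ : IsDerivedMonoidal γ := derivedLaxBraided_isDerivedMonoidal γ hP
  exact ⟨m, s, derivedMonoidalClosed γ hV hγ, l, hγ⟩

/-- The homotopy category of a symmetric monoidal model category has a derived closed symmetric
monoidal structure. -/
theorem exists_derivedMonoidal {H : Type u₂} [Category.{v₂} H] (γ : V ⥤ H)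
    [γ.IsLocalization (weakEquivalences V)] (hV : IsMonoidalModelCategory V) :
    ∃ (_ : MonoidalCategory H) (_ : SymmetricCategory H) (_ : MonoidalClosed H)
      (_ : γ.LaxBraided), IsDerivedMonoidal γ := by
  let P := cofibrantOrUnit V
  have hP : cofibrantObjects V ≤ P := fun x hx ↦ Or.inl hx
  have : P.IsMonoidal := hV.isMonoidal_cofibrantOrUnit
  have : (subWeakEquivalences P).IsMonoidal :=
    { id_mem x := (weakEquivalences V).id_mem x.obj
      comp_mem f g hf hg := (weakEquivalences V).comp_mem f.hom g.hom hf hg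
      whiskerLeft x y₁ y₂ g hg := by
        have : WeakEquivalence g.hom := (weakEquivalence_iff _).2 hg
        exact (weakEquivalence_iff _).1 (hV.weakEquivalence_whiskerLeft_of_cofibrantOrUnit
          x.property y₁.property y₂.property g.hom)
      whiskerRight {x₁ x₂} f hf y := by
        have : WeakEquivalence f.hom := (weakEquivalence_iff _).2 hf
        exact (weakEquivalence_iff _).1 ((weakEquivalence_whiskerRight_iff y.obj f.hom).2
          (hV.weakEquivalence_whiskerLeft_of_cofibrantOrUnit
            y.property x₁.property x₂.property f.hom)) }
  have := isLocalization_ι_comp γ P hP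
  let u : (P.ι ⋙ γ).obj (𝟙_ _) ≅ γ.obj (𝟙_ V) := Iso.refl _
  have h : (Localization.Monoidal.toMonoidalCategory (P.ι ⋙ γ) (subWeakEquivalences P) u).Braided :=
    inferInstance
  exact exists_laxBraided (H := LocalizedMonoidal (P.ι ⋙ γ) (subWeakEquivalences P) u)
    (m := inferInstance) (s := inferInstance) γ (P := P) hV hP
    (hL := ‹_›) (hB := h)

end Existence

/-! ### Opposite model categories and opposite enrichments -/

section Opposite

variable {C : Type u₁} [Category.{v₁} C] [ModelCategory C]

lemma isCofibrant_op (x : C) [IsFibrant x] : IsCofibrant (op x) := by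
  rw [isCofibrant_iff_of_isInitial (terminal.from x).op (initialOpOfTerminal terminalIsTerminal)]
  infer_instance

lemma isFibrant_unop (x : Cᵒᵖ) [IsCofibrant x] : IsFibrant x.unop := by
  rw [isFibrant_iff_of_isTerminal (initial.to x).unop (terminalUnopOfInitial initialIsInitial)]
  infer_instance

lemma isCofibrant_unop (x : Cᵒᵖ) [IsFibrant x] : IsCofibrant x.unop := by
  rw [isCofibrant_iff_of_isInitial (terminal.from x).unop
    (initialUnopOfTerminal terminalIsTerminal)]
  infer_instance

end Opposite

section Whisker

variable {W : Type u₁} [Category.{v₁} W] [MonoidalCategory W] [BraidedCategory W]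
  {D : Type u₂} [Category.{v₂} D] [EnrichedOrdinaryCategory W D]

lemma eHomWhiskerLeft_op (x : Dᵒᵖ) {y y' : Dᵒᵖ} (g : y ⟶ y') :
    eHomWhiskerLeft W x g = eHomWhiskerRight W g.unop x.unop := by
  dsimp only [eHomWhiskerLeft, eHomWhiskerRight]
  change (ρ_ (y.unop ⟶[W] x.unop)).inv ≫ (y.unop ⟶[W] x.unop) ◁ eHomEquiv W g.unop ≫
    (β_ _ _).hom ≫ eComp W y'.unop y.unop x.unop = _
  rw [BraidedCategory.braiding_naturality_right_assoc, rightUnitor_inv_braiding_assoc]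

lemma eHomWhiskerRight_op {x x' : Dᵒᵖ} (f : x ⟶ x') (y : Dᵒᵖ) :
    eHomWhiskerRight W f y = eHomWhiskerLeft W y.unop f.unop := by
  dsimp only [eHomWhiskerLeft, eHomWhiskerRight]
  change (λ_ (y.unop ⟶[W] x'.unop)).inv ≫ eHomEquiv W f.unop ▷ (y.unop ⟶[W] x'.unop) ≫
    (β_ _ _).hom ≫ eComp W y.unop x'.unop x.unop = _
  rw [BraidedCategory.braiding_naturality_left_assoc, leftUnitor_inv_braiding_assoc]

end Whisker

/-! ### Consequences of SM7 for hom-objects -/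

section EHom

variable (V : Type u₁) [Category.{v₁} V] [ModelCategory V] [MonoidalCategory V]
  (C : Type u₂) [Category.{v₂} C] [EnrichedOrdinaryCategory V C] [ModelCategory C]

/-- The hom-objects bifunctor of `C` is homotopically well-behaved: its values out of cofibrant
objects into fibrant objects are fibrant, and it sends acyclic fibrations in the target and acyclic
cofibrations in the source to weak equivalences. -/
structure EHomHomotopical : Prop where
  isFibrant (x y : C) [IsCofibrant x] [IsFibrant y] :
    IsFibrant (EnrichedCategory.Hom x y : V)
  weakEquivalence_whiskerLeft_of_fibration (x : C) [IsCofibrant x] {y y' : C} (p : y ⟶ y')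
    [Fibration p] [WeakEquivalence p] : WeakEquivalence (eHomWhiskerLeft V x p)
  weakEquivalence_whiskerRight_of_cofibration {x x' : C} (i : x ⟶ x') [Cofibration i]
    [WeakEquivalence i] (y : C) [IsFibrant y] : WeakEquivalence (eHomWhiskerRight V i y)

variable {V C}

/-- The pullback square associated to a morphism out of an initial object. -/
@[simps]
def pullbackObjObjOfIsInitial (hC : EnrichedInitialTerminal V C) {I x y y' : C} (i : I ⟶ x)
    (p : y ⟶ y') (hI : IsInitial I) : (eHomFunctor V C).PullbackObjObj i p where
  pt := EnrichedCategory.Hom x y'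
  fst := (hC.initial hI y).some.from _
  snd := 𝟙 _
  isPullback := by
    have : IsIso (((eHomFunctor V C).obj (op I)).map p) :=
      isIso_of_isTerminal (hC.initial hI y).some (hC.initial hI y').some _
    apply +allowSynthFailures IsPullback.of_vert_isIso
    · exact inferInstanceAs (IsIso (𝟙 (x ⟶[V] y')))
    · exact ⟨(hC.initial hI y').some.hom_ext _ _⟩
  π := eHomWhiskerLeft V x p
  π_fst := (hC.initial hI y).some.hom_ext _ _
  π_snd := comp_id _

/-- The pullback square associated to a morphism into a terminal object. -/
@[simps]
def pullbackObjObjOfIsTerminal (hC : EnrichedInitialTerminal V C) {x x' y T : C} (i : x ⟶ x')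
    (p : y ⟶ T) (hT : IsTerminal T) : (eHomFunctor V C).PullbackObjObj i p where
  pt := EnrichedCategory.Hom x y
  fst := 𝟙 _
  snd := (hC.terminal hT x').some.from _
  isPullback := by
    have : IsIso (((eHomFunctor V C).map i.op).app T) :=
      isIso_of_isTerminal (hC.terminal hT x').some (hC.terminal hT x).some _
    apply +allowSynthFailures IsPullback.of_horiz_isIso
    · exact inferInstanceAs (IsIso (𝟙 (x ⟶[V] y)))
    · exact ⟨(hC.terminal hT x).some.hom_ext _ _⟩
  π := eHomWhiskerRight V i y
  π_fst := comp_id _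
  π_snd := (hC.terminal hT x').some.hom_ext _ _

/-- SM7 applied to `∅ ⟶ x` or to `y ⟶ *`: since homs out of `∅` and into `*` are terminal, the
pullback collapses to one factor. -/
lemma SM7.eHomHomotopical (h : SM7 V C) (hC : EnrichedInitialTerminal V C) :
    EHomHomotopical V C where
  isFibrant x y _ _ := by
    have : Fibration (eHomWhiskerLeft V x (terminal.from y)) :=
      h.fibration _ _
        (pullbackObjObjOfIsInitial hC (initial.to x) (terminal.from y) initialIsInitial)
    rwa [isFibrant_iff_of_isTerminal (eHomWhiskerLeft V x (terminal.from y))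
      (hC.terminal terminalIsTerminal x).some]
  weakEquivalence_whiskerLeft_of_fibration x _ _ _ p _ _ :=
    h.acyclic_right _ _ (pullbackObjObjOfIsInitial hC (initial.to x) p initialIsInitial)
  weakEquivalence_whiskerRight_of_cofibration i _ _ y _ :=
    h.acyclic_left _ _ (pullbackObjObjOfIsTerminal hC i (terminal.from y) terminalIsTerminal)

namespace EHomHomotopical

/-- The conditions are self-dual, which is what lets cotensorings be treated as tensorings of `Cᵒᵖ`.
-/
lemma op [BraidedCategory V] (h : EHomHomotopical V C) : EHomHomotopical V Cᵒᵖ where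
  isFibrant x y _ _ := by
    have := isFibrant_unop x
    have := isCofibrant_unop y
    exact h.isFibrant y.unop x.unop
  weakEquivalence_whiskerLeft_of_fibration x _ _ _ p _ _ := by
    have := isFibrant_unop x
    rw [eHomWhiskerLeft_op]
    exact h.weakEquivalence_whiskerRight_of_cofibration p.unop x.unop
  weakEquivalence_whiskerRight_of_cofibration i _ _ y _ := by
    have := isCofibrant_unop y
    rw [eHomWhiskerRight_op]
    exact h.weakEquivalence_whiskerLeft_of_fibration y.unop i.unop

lemma weakEquivalence_whiskerLeft (hE : EHomHomotopical V C) (x : C) [IsCofibrant x] {y y' : C}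
    (f : y ⟶ y') [IsFibrant y] [IsFibrant y'] [WeakEquivalence f] :
    WeakEquivalence (eHomWhiskerLeft V x f) := by
  let h : FibrantBrownFactorization f := Classical.arbitrary _
  have h₁ := hE.weakEquivalence_whiskerLeft_of_fibration x h.p
  have h₂ := hE.weakEquivalence_whiskerLeft_of_fibration x h.r
  have h₃ : WeakEquivalence (eHomWhiskerLeft V x h.i) :=
    weakEquivalence_of_postcomp_of_fac (g := eHomWhiskerLeft V x h.r) (fg := 𝟙 _)
      (by rw [← eHomWhiskerLeft_comp, h.i_r, eHomWhiskerLeft_id])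
  rw [← h.fac, eHomWhiskerLeft_comp]
  infer_instance

lemma weakEquivalence_whiskerRight (hE : EHomHomotopical V C) {x x' : C} (f : x ⟶ x') (y : C)
    [IsFibrant y] [IsCofibrant x] [IsCofibrant x'] [WeakEquivalence f] :
    WeakEquivalence (eHomWhiskerRight V f y) := by
  let h : CofibrantBrownFactorization f := Classical.arbitrary _
  have h₁ := hE.weakEquivalence_whiskerRight_of_cofibration h.i y
  have h₂ := hE.weakEquivalence_whiskerRight_of_cofibration h.s y
  have h₃ : WeakEquivalence (eHomWhiskerRight V h.p y) :=
    weakEquivalence_of_postcomp_of_fac (g := eHomWhiskerRight V h.s y) (fg := 𝟙 _)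
      (by rw [← eHomWhiskerRight_comp, h.s_p, eHomWhiskerRight_id])
  rw [← h.fac, eHomWhiskerRight_comp]
  infer_instance

end EHomHomotopical

end EHom

/-! ### Formal lemmas on enriched categories -/

section Enriched

variable (W : Type u₁) [Category.{v₁} W] [MonoidalCategory W]
  {D : Type u₂} [Category.{v₂} D] [EnrichedOrdinaryCategory W D]

lemma eHomEquiv_eHomWhiskerRight {x x' y : D} (f : x ⟶ x') (g : x' ⟶ y) :
    eHomEquiv W g ≫ eHomWhiskerRight W f y = eHomEquiv W (f ≫ g) := by
  rw [eHomWhiskerRight, leftUnitor_inv_naturality_assoc, whisker_exchange_assoc, eHomEquiv_comp,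
    tensorHom_def_assoc]

lemma eHomEquiv_eHomWhiskerLeft {x y y' : D} (f : x ⟶ y) (g : y ⟶ y') :
    eHomEquiv W f ≫ eHomWhiskerLeft W x g = eHomEquiv W (f ≫ g) := by
  rw [eHomWhiskerLeft, rightUnitor_inv_naturality_assoc, ← whisker_exchange_assoc, eHomEquiv_comp,
    tensorHom_def'_assoc, unitors_inv_equal]

/-- Associativity of composition, with `f` as the middle factor. -/
lemma eHomWhiskerLeft_whiskerRight_eComp (x z : D) {y y' : D} (f : y ⟶ y') :
    eHomWhiskerLeft W x f ▷ _ ≫ eComp W x y' z = _ ◁ eHomWhiskerRight W f z ≫ eComp W x y z := by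
  simp only [eHomWhiskerLeft, eHomWhiskerRight, MonoidalCategory.whiskerLeft_comp_assoc,
    whisker_assoc_symm, triangle_assoc_comp_left_inv_assoc, e_assoc', assoc, comp_whiskerRight]

instance {x y y' : D} (g : y ⟶ y') [IsIso g] : IsIso (eHomWhiskerLeft W x g) :=
  ⟨eHomWhiskerLeft W x (inv g), by simp [← eHomWhiskerLeft_comp],
    by simp [← eHomWhiskerLeft_comp]⟩

instance {x x' y : D} (f : x ⟶ x') [IsIso f] : IsIso (eHomWhiskerRight W f y) :=
  ⟨eHomWhiskerRight W (inv f) y, by simp [← eHomWhiskerRight_comp],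
    by simp [← eHomWhiskerRight_comp]⟩

variable {W} {ι : Type*} {a b : ι → D} (p : ∀ i, b i ⟶ a i)

/-- Maps between hom-objects given by lifting along `p` are compatible with compositions. -/
lemma eComp_lift [∀ i j, Mono (eHomWhiskerLeft W (b i) (p j))]
    (F : ∀ i j, (EnrichedCategory.Hom (a i) (a j) : W) ⟶ EnrichedCategory.Hom (b i) (b j))
    (hF : ∀ i j, F i j ≫ eHomWhiskerLeft W (b i) (p j) = eHomWhiskerRight W (p i) (a j))
    (i j k : ι) :
    eComp W (a i) (a j) (a k) ≫ F i k = (F i j ⊗ₘ F j k) ≫ eComp W (b i) (b j) (b k) := by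
  rw [← cancel_mono (eHomWhiskerLeft W (b i) (p k)), assoc, assoc, hF, eComp_eHomWhiskerRight,
    eComp_eHomWhiskerLeft, tensorHom_def_assoc, ← MonoidalCategory.whiskerLeft_comp_assoc, hF,
    ← eHomWhiskerLeft_whiskerRight_eComp, ← comp_whiskerRight_assoc, hF]

/-- Maps between hom-objects given by extension along `p` are compatible with compositions. -/
lemma eComp_extend [∀ i j, Mono (eHomWhiskerRight W (p i) (a j))]
    (F : ∀ i j, (EnrichedCategory.Hom (b i) (b j) : W) ⟶ EnrichedCategory.Hom (a i) (a j))
    (hF : ∀ i j, F i j ≫ eHomWhiskerRight W (p i) (a j) = eHomWhiskerLeft W (b i) (p j))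
    (i j k : ι) :
    eComp W (b i) (b j) (b k) ≫ F i k = (F i j ⊗ₘ F j k) ≫ eComp W (a i) (a j) (a k) := by
  rw [← cancel_mono (eHomWhiskerRight W (p i) (a k)), assoc, assoc, hF, eComp_eHomWhiskerLeft,
    eComp_eHomWhiskerRight, tensorHom_def'_assoc, ← comp_whiskerRight_assoc, hF,
    eHomWhiskerLeft_whiskerRight_eComp, ← MonoidalCategory.whiskerLeft_comp_assoc, hF]

/-- The enrichment of a category which is induced by a fully faithful functor to
an enriched category. -/
@[reducible]
def enrichedOfFullyFaithful {E : Type u₃} [Category.{v₃} E] {G : E ⥤ D} (hG : G.FullyFaithful) :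
    EnrichedOrdinaryCategory W E where
  Hom X Y := EnrichedCategory.Hom (G.obj X) (G.obj Y)
  id X := eId W (G.obj X)
  comp X Y Z := eComp W (G.obj X) (G.obj Y) (G.obj Z)
  id_comp _ _ := e_id_comp W _ _
  comp_id _ _ := e_comp_id W _ _
  assoc _ _ _ _ := e_assoc W _ _ _ _
  homEquiv := hG.homEquiv.trans (eHomEquiv W)
  homEquiv_id X := by
    refine Eq.trans ?_ (eHomEquiv_id W (G.obj X))
    exact congrArg (eHomEquiv W) (G.map_id X)
  homEquiv_comp f g := by
    refine Eq.trans ?_ (eHomEquiv_comp W (G.map f) (G.map g))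
    exact congrArg (eHomEquiv W) (G.map_comp f g)

end Enriched

/-! ### Change of enrichment along the localization functor -/

section Comparison

variable {V : Type u₁} [Category.{v₁} V] [MonoidalCategory V]
  {H : Type u₂} [Category.{v₂} H] [MonoidalCategory H] (γ : V ⥤ H) [γ.LaxMonoidal]
  {C : Type u₃} [Category.{v₃} C] [EnrichedOrdinaryCategory V C]

open Functor.LaxMonoidal

/-- The data of maps `γ C(x, y) ⟶ D(J x, J y)` which make `J` a `γ`-enriched functor from the
`V`-category `C` to the `H`-category `D`. -/
structure HomComparison {D : Type u₄} [Category.{v₄} D] [EnrichedOrdinaryCategory H D]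
    (J : C ⥤ D) where
  /-- the map `γ C(x, y) ⟶ D(J x, J y)` -/
  map (x y : C) : γ.obj (EnrichedCategory.Hom x y) ⟶ EnrichedCategory.Hom (J.obj x) (J.obj y)
  map_comp (x y z : C) :
    μ γ _ _ ≫ γ.map (eComp V x y z) ≫ map x z =
      (map x y ⊗ₘ map y z) ≫ eComp H (J.obj x) (J.obj y) (J.obj z)
  map_hom {x y : C} (f : x ⟶ y) : ε γ ≫ γ.map (eHomEquiv V f) ≫ map x y = eHomEquiv H (J.map f)

namespace HomComparison

variable {γ} {D : Type u₄} [Category.{v₄} D] [EnrichedOrdinaryCategory H D] {J : C ⥤ D}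
  (c : HomComparison γ J)

lemma whiskerLeft_map (x : C) {y y' : C} (f : y ⟶ y') :
    γ.map (eHomWhiskerLeft V x f) ≫ c.map x y' =
      c.map x y ≫ eHomWhiskerLeft H (J.obj x) (J.map f) := by
  rw [eHomWhiskerLeft, eHomWhiskerLeft, γ.map_comp, γ.map_comp, assoc, assoc,
    rightUnitor_inv_naturality_assoc, ← tensorHom_def_assoc, ← c.map_hom]
  have : (c.map x y ⊗ₘ (ε γ ≫ γ.map (eHomEquiv V f) ≫ c.map y y')) =
      _ ◁ ε γ ≫ _ ◁ γ.map (eHomEquiv V f) ≫ (c.map x y ⊗ₘ c.map y y') := by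
    simp [tensorHom_def']
  rw [this, assoc, assoc, ← c.map_comp, μ_natural_right_assoc, right_unitality_inv_assoc]

lemma whiskerRight_map {x x' : C} (f : x ⟶ x') (y : C) :
    γ.map (eHomWhiskerRight V f y) ≫ c.map x y =
      c.map x' y ≫ eHomWhiskerRight H (J.map f) (J.obj y) := by
  rw [eHomWhiskerRight, eHomWhiskerRight, γ.map_comp, γ.map_comp, assoc, assoc,
    leftUnitor_inv_naturality_assoc, ← tensorHom_def'_assoc, ← c.map_hom]
  have : ((ε γ ≫ γ.map (eHomEquiv V f) ≫ c.map x x') ⊗ₘ c.map x' y) =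
      ε γ ▷ _ ≫ γ.map (eHomEquiv V f) ▷ _ ≫ (c.map x x' ⊗ₘ c.map x' y) := by
    simp [MonoidalCategory.tensorHom_def]
  rw [this, assoc, assoc, ← c.map_comp, μ_natural_left_assoc, left_unitality_inv_assoc]

end HomComparison

variable (C)

/-- The `H`-category with the same objects as `C` and hom-objects `γ C(x, y)`. -/
def Transported : Type u₃ := ForgetEnrichment H (TransportEnrichment γ C)

instance : Category (Transported γ C) :=
  inferInstanceAs (Category (ForgetEnrichment H (TransportEnrichment γ C)))

instance : EnrichedOrdinaryCategory H (Transported γ C) :=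
  inferInstanceAs (EnrichedOrdinaryCategory H (ForgetEnrichment H (TransportEnrichment γ C)))

variable {C}

lemma eHomEquiv_comp_map {x y z : C} (f : x ⟶ y) (g : y ⟶ z) :
    ε γ ≫ γ.map (eHomEquiv V (f ≫ g)) =
      (λ_ _).inv ≫ ((ε γ ≫ γ.map (eHomEquiv V f)) ⊗ₘ (ε γ ≫ γ.map (eHomEquiv V g))) ≫
        μ γ _ _ ≫ γ.map (eComp V x y z) := by
  rw [← tensorHom_comp_tensorHom_assoc, μ_natural_assoc, eHomEquiv_comp, γ.map_comp, γ.map_comp,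
    tensorHom_def'_assoc, ← left_unitality_inv_assoc, leftUnitor_inv_naturality_assoc]

variable (C)

/-- The functor from `C` to the underlying category of the `H`-category with
hom-objects `γ C(x, y)`. -/
def toTransported : C ⥤ Transported γ C where
  obj x := ForgetEnrichment.of H (C := TransportEnrichment γ C) x
  map {x y} f := ForgetEnrichment.homOf (C := TransportEnrichment γ C) H
    (ε γ ≫ γ.map (eHomEquiv V (X := x) (Y := y) f))
  map_id x := (congrArg (fun f ↦ ForgetEnrichment.homOf (C := TransportEnrichment γ C) H
    (ε γ ≫ γ.map f)) (eHomEquiv_id V x)).trans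
      (ForgetEnrichment.homOf_eId H (C := TransportEnrichment γ C) x)
  map_comp f g := (eHomEquiv_comp_map γ f g).trans (assoc _ _ _).symm

/-- The identity maps exhibit `toTransported γ C` as a `γ`-enriched functor. -/
def toTransportedComparison : HomComparison γ (toTransported γ C) where
  map x y := 𝟙 (γ.obj (EnrichedCategory.Hom x y))
  map_comp x y z := (congrArg (fun f ↦ μ γ _ _ ≫ f) (comp_id _)).trans
    ((id_comp _).symm.trans
      (congrArg (fun f ↦ f ≫ μ γ _ _ ≫ γ.map (eComp V x y z)) (id_tensorHom_id _ _).symm))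
  map_hom _ := congrArg (fun g ↦ ε γ ≫ g) (comp_id _)

instance (x y : C) : IsIso ((toTransportedComparison γ C).map x y) :=
  inferInstanceAs (IsIso (𝟙 (γ.obj (EnrichedCategory.Hom x y))))

end Comparison

/-! ### Bifibrant zigzags -/

section

variable {M : Type u₁} [Category.{v₁} M] [ModelCategory M]

/-- A zigzag of an acyclic fibration `Q ⟶ x` and an acyclic cofibration `Q ⟶ B`
with `Q` cofibrant and `B` bifibrant. -/
structure BifibrantZigzag (x : M) where
  /-- the cofibrant resolution -/
  Q : M
  /-- the bifibrant object -/
  B : M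
  /-- the acyclic fibration -/
  q : Q ⟶ x
  /-- the acyclic cofibration -/
  j : Q ⟶ B
  [isCofibrant_Q : IsCofibrant Q]
  [isCofibrant_B : IsCofibrant B]
  [isFibrant_B : IsFibrant B]
  [fibration_q : Fibration q]
  [weakEquivalence_q : WeakEquivalence q]
  [cofibration_j : Cofibration j]
  [weakEquivalence_j : WeakEquivalence j]

attribute [instance] BifibrantZigzag.isCofibrant_Q BifibrantZigzag.isCofibrant_B
  BifibrantZigzag.isFibrant_B BifibrantZigzag.fibration_q BifibrantZigzag.weakEquivalence_q
  BifibrantZigzag.cofibration_j BifibrantZigzag.weakEquivalence_j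

instance (x : M) : Nonempty (BifibrantZigzag x) := by
  obtain ⟨Q, _, q, _, _⟩ := CofibrantObject.HoCat.exists_resolution x
  obtain ⟨B, j, _, _, _⟩ := exists_fibrant_replacement Q
  have := isCofibrant_of_cofibration j
  exact ⟨{ Q := Q, B := B, q := q, j := j }⟩

end

section IsIso

variable {V : Type u₁} [Category.{v₁} V] [MonoidalCategory V] [ModelCategory V]
  {C : Type u₂} [Category.{v₂} C] [EnrichedOrdinaryCategory V C]
  {H : Type u₃} [Category.{v₃} H] [MonoidalCategory H] {γ : V ⥤ H} [γ.LaxMonoidal]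
  [γ.IsLocalization (weakEquivalences V)]
  {D : Type u₄} [Category.{v₄} D] [EnrichedOrdinaryCategory H D] {J : C ⥤ D}
  (c : HomComparison γ J)

lemma HomComparison.isIso_whiskerLeft (x : C) {y y' : C} (f : y ⟶ y')
    [IsIso (c.map x y)] [IsIso (c.map x y')] [WeakEquivalence (eHomWhiskerLeft V x f)] :
    IsIso (eHomWhiskerLeft H (J.obj x) (J.map f)) := by
  have := isIso_map_of_weakEquivalence γ (eHomWhiskerLeft V x f)
  exact IsIso.of_isIso_fac_left (c.whiskerLeft_map x f).symm

lemma HomComparison.isIso_whiskerRight {x x' : C} (f : x ⟶ x') (y : C)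
    [IsIso (c.map x y)] [IsIso (c.map x' y)] [WeakEquivalence (eHomWhiskerRight V f y)] :
    IsIso (eHomWhiskerRight H (J.map f) (J.obj y)) := by
  have := isIso_map_of_weakEquivalence γ (eHomWhiskerRight V f y)
  exact IsIso.of_isIso_fac_left (c.whiskerRight_map f y).symm

end IsIso

/-! ### Embedding the homotopy category by means of the `π₀` axiom -/

section Enrichment

variable {V : Type u₁} [Category.{v₁} V] [MonoidalCategory V]
  {C : Type u₂} [Category.{v₂} C] [EnrichedOrdinaryCategory V C] [ModelCategory C]
  {H : Type u₃} [Category.{v₃} H] [MonoidalCategory H] (γ : V ⥤ H) [γ.LaxMonoidal]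
  {H' : Type u₄} [Category.{v₄} H'] {γC : C ⥤ H'}
  (hπ : PiZeroAxiom γ γC)

open Functor.LaxMonoidal

namespace PiZeroAxiom

variable {γ} (x y z : C)

/-- The map from `[x, y]` to the maps in the category with hom-objects `γ C(x, y)`. -/
def toTransportedHom [IsCofibrant x] [IsFibrant y] (g : γC.obj x ⟶ γC.obj y) :
    (toTransported γ C).obj x ⟶ (toTransported γ C).obj y :=
  (eHomEquiv H).symm (ε γ ≫ (hπ x y).choose g ≫ (toTransportedComparison γ C).map x y)

lemma toTransportedHom_map {x y : C} [IsCofibrant x] [IsFibrant y] (f : x ⟶ y) :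
    hπ.toTransportedHom x y (γC.map f) = (toTransported γ C).map f := by
  rw [toTransportedHom, (hπ x y).choose_spec.1, Equiv.symm_apply_eq, HomComparison.map_hom]

lemma bijective_toTransportedHom [IsIso (ε γ)] [IsCofibrant x] [IsFibrant y] :
    Function.Bijective (hπ.toTransportedHom x y) := by
  have h := ((asIso (ε γ)).symm.homCongr
    (asIso ((toTransportedComparison γ C).map x y))).bijective.comp (hπ x y).choose_spec.2
  exact (eHomEquiv H).symm.bijective.comp h

variable [γC.IsLocalization (weakEquivalences C)]

/-- The `π₀` bijection is only prescribed on classes of maps of `C`; as `y` is cofibrant and `z`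
fibrant, `g` is such a class. -/
lemma map_comp_toTransportedHom {x y z : C} [IsCofibrant x] [IsCofibrant y] [IsFibrant z]
    (f : x ⟶ y) (g : γC.obj y ⟶ γC.obj z) :
    hπ.toTransportedHom x z (γC.map f ≫ g) =
      (toTransported γ C).map f ≫ hπ.toTransportedHom y z g := by
  obtain ⟨g, rfl⟩ := map_surjective_of_isLocalization γC _ _ g
  rw [← γC.map_comp, toTransportedHom_map, toTransportedHom_map, Functor.map_comp]

lemma toTransportedHom_comp {x y z : C} [IsCofibrant x] [IsCofibrant y] [IsFibrant y]
    [IsFibrant z] (f : γC.obj x ⟶ γC.obj y) (g : γC.obj y ⟶ γC.obj z) :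
    hπ.toTransportedHom x z (f ≫ g) =
      hπ.toTransportedHom x y f ≫ hπ.toTransportedHom y z g := by
  obtain ⟨f, rfl⟩ := map_surjective_of_isLocalization γC _ _ f
  rw [map_comp_toTransportedHom, toTransportedHom_map]

lemma isIso_toTransportedHom {x y : C} [IsCofibrant x] [IsCofibrant y] [IsFibrant x]
    [IsFibrant y] (f : γC.obj x ⟶ γC.obj y) [IsIso f] : IsIso (hπ.toTransportedHom x y f) := by
  refine ⟨hπ.toTransportedHom y x (inv f), ?_, ?_⟩
  · rw [← toTransportedHom_comp, IsIso.hom_inv_id, ← γC.map_id, toTransportedHom_map,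
      CategoryTheory.Functor.map_id]
  · rw [← toTransportedHom_comp, IsIso.inv_hom_id, ← γC.map_id, toTransportedHom_map,
      CategoryTheory.Functor.map_id]

end PiZeroAxiom

variable (γC) [γC.IsLocalization (weakEquivalences C)]

/-- A choice of a bifibrant object of `C` representing an object of the homotopy category. -/
structure BifibrantModel (X : H') where
  /-- the bifibrant object -/
  obj : C
  [isCofibrant : IsCofibrant obj]
  [isFibrant : IsFibrant obj]
  /-- the isomorphism -/
  iso : γC.obj obj ≅ X

attribute [instance] BifibrantModel.isCofibrant BifibrantModel.isFibrant

instance (X : H') : Nonempty (BifibrantModel γC X) := by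
  obtain ⟨x, _, _, ⟨e⟩⟩ := exists_bifibrant_iso γC X
  exact ⟨{ obj := x, iso := e }⟩

variable {γC}

variable (R : ∀ X : H', BifibrantModel γC X) (Z : ∀ x : C, BifibrantZigzag x)

namespace PiZeroAxiom

/-- The functor from the homotopy category of `C` to the category
with hom-objects `γ C(x, y)`, which sends an object to a bifibrant model of it. -/
def modelFunctor : H' ⥤ Transported γ C where
  obj X := (toTransported γ C).obj (R X).obj
  map {X Y} f := hπ.toTransportedHom _ _ ((R X).iso.hom ≫ f ≫ (R Y).iso.inv)
  map_id X := by
    rw [id_comp, Iso.hom_inv_id, ← γC.map_id, toTransportedHom_map,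
      CategoryTheory.Functor.map_id]
  map_comp f g := by
    rw [← toTransportedHom_comp]
    simp

/-- The functor `modelFunctor` is fully faithful. -/
def fullyFaithfulModelFunctor [IsIso (ε γ)] : (hπ.modelFunctor γ R).FullyFaithful := by
  have h (X Y : H') : Function.Bijective ((hπ.modelFunctor γ R).map (X := X) (Y := Y)) :=
    (hπ.bijective_toTransportedHom _ _).comp
      ((R X).iso.symm.homCongr (R Y).iso.symm).bijective
  have : (hπ.modelFunctor γ R).Full := ⟨(h _ _).2⟩
  have : (hπ.modelFunctor γ R).Faithful := ⟨fun h' ↦ (h _ _).1 h'⟩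
  exact .ofFullyFaithful _

/-- The map from the cofibrant resolution of `x` to the chosen bifibrant model of `γC x`. -/
def toModel (x : C) : (toTransported γ C).obj (Z x).Q ⟶ (hπ.modelFunctor γ R).obj (γC.obj x) :=
  hπ.toTransportedHom (Z x).Q (R (γC.obj x)).obj (γC.map (Z x).q ≫ (R (γC.obj x)).iso.inv)

/-- `Qx ⟶ B` followed by an isomorphism between bifibrant models. Only the first factor comes from
`C`, and it is an acyclic cofibration, to which SM7 applies. -/
lemma exists_toModel_eq (x : C) :
    ∃ (u : (toTransported γ C).obj (Z x).B ⟶ (hπ.modelFunctor γ R).obj (γC.obj x)) (_ : IsIso u),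
      hπ.toModel γ R Z x = (toTransported γ C).map (Z x).j ≫ u := by
  have := isIso_map_of_weakEquivalence γC (Z x).q
  have := isIso_map_of_weakEquivalence γC (Z x).j
  refine ⟨_, hπ.isIso_toTransportedHom (inv (γC.map (Z x).j) ≫ γC.map (Z x).q ≫
    (R (γC.obj x)).iso.inv), ?_⟩
  have h := hπ.map_comp_toTransportedHom (Z x).j (inv (γC.map (Z x).j) ≫ γC.map (Z x).q ≫
    (R (γC.obj x)).iso.inv)
  rw [IsIso.hom_inv_id_assoc] at h
  exact h

lemma map_comp_toModel {x y : C} {f : x ⟶ y} {f' : (Z x).Q ⟶ (Z y).Q}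
    (h : f' ≫ (Z y).q = (Z x).q ≫ f) :
    (toTransported γ C).map f' ≫ hπ.toModel γ R Z y =
      hπ.toModel γ R Z x ≫ (hπ.modelFunctor γ R).map (γC.map f) := by
  dsimp [toModel, modelFunctor]
  rw [← map_comp_toTransportedHom, ← toTransportedHom_comp, ← γC.map_comp_assoc, h]
  simp

end PiZeroAxiom

end Enrichment

/-! ### Construction of the derived enrichment -/

section Derived

variable {V : Type u₁} [Category.{v₁} V] [MonoidalCategory V] [ModelCategory V]
  {C : Type u₂} [Category.{v₂} C] [EnrichedOrdinaryCategory V C] [ModelCategory C]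
  {H : Type u₃} [Category.{v₃} H] [MonoidalCategory H] {γ : V ⥤ H} [γ.LaxMonoidal]
  {H' : Type u₄} [Category.{v₄} H'] {γC : C ⥤ H'} [γ.IsLocalization (weakEquivalences V)]
  [γC.IsLocalization (weakEquivalences C)]

open Functor.LaxMonoidal

/-- The homotopy category of an enriched model category is enriched in the homotopy category
of the base. -/
theorem exists_derivedEnrichment (hE : EHomHomotopical V C) (hγ : IsDerivedMonoidal γ)
    (hπ : PiZeroAxiom γ γC) :
    ∃ _ : EnrichedOrdinaryCategory H H', Nonempty (DerivedEnrichment γ γC) := by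
  have := hγ.isIso_ε
  let R (X : H') : BifibrantModel γC X := Classical.arbitrary _
  let Z (x : C) : BifibrantZigzag x := Classical.arbitrary _
  let J := toTransported γ C
  let c := toTransportedComparison γ C
  let G := hπ.modelFunctor γ R
  let hG : G.FullyFaithful := hπ.fullyFaithfulModelFunctor γ R
  have hq (x y : C) : IsIso (eHomWhiskerLeft H (J.obj (Z x).Q) (J.map (Z y).q)) := by
    have := hE.weakEquivalence_whiskerLeft_of_fibration (Z x).Q (Z y).q
    exact c.isIso_whiskerLeft _ _
  have hm (x y : C) : IsIso (eHomWhiskerRight H (hπ.toModel γ R Z x) (G.obj (γC.obj y))) := by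
    obtain ⟨u, _, hu⟩ := hπ.exists_toModel_eq γ R Z x
    have := hE.weakEquivalence_whiskerRight_of_cofibration (Z x).j (R (γC.obj y)).obj
    have : IsIso (eHomWhiskerRight H (J.map (Z x).j) (G.obj (γC.obj y))) :=
      c.isIso_whiskerRight (Z x).j (R (γC.obj y)).obj
    rw [hu, eHomWhiskerRight_comp]
    infer_instance
  -- `F` restricts along `Qx ⟶ x` and lifts along `Qy ⟶ y`. `F'` pushes forward to the model of `y`
  -- and extends along the map from `Qx` to the model of `x`.
  obtain ⟨F, hF⟩ : ∃ F : ∀ x y, (EnrichedCategory.Hom (J.obj x) (J.obj y) : H) ⟶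
      EnrichedCategory.Hom (J.obj (Z x).Q) (J.obj (Z y).Q),
      ∀ x y, F x y ≫ eHomWhiskerLeft H _ (J.map (Z y).q) =
        eHomWhiskerRight H (J.map (Z x).q) (J.obj y) :=
    ⟨fun x y ↦ eHomWhiskerRight H (J.map (Z x).q) _ ≫ inv (eHomWhiskerLeft H _ (J.map (Z y).q)),
      fun x y ↦ by rw [assoc, IsIso.inv_hom_id, comp_id]⟩
  obtain ⟨F', hF'⟩ : ∃ F' : ∀ x y, (EnrichedCategory.Hom (J.obj (Z x).Q) (J.obj (Z y).Q) : H) ⟶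
      EnrichedCategory.Hom (G.obj (γC.obj x)) (G.obj (γC.obj y)),
      ∀ x y, F' x y ≫ eHomWhiskerRight H (hπ.toModel γ R Z x) _ =
        eHomWhiskerLeft H (J.obj (Z x).Q) (hπ.toModel γ R Z y) :=
    ⟨fun x y ↦ eHomWhiskerLeft H _ (hπ.toModel γ R Z y) ≫
      inv (eHomWhiskerRight H (hπ.toModel γ R Z x) _),
      fun x y ↦ by rw [assoc, IsIso.inv_hom_id, comp_id]⟩
  have hcF := eComp_lift (fun x ↦ J.map (Z x).q) F hF
  have hcF' := eComp_extend (hπ.toModel γ R Z) F' hF'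
  let e : EnrichedOrdinaryCategory H H' := enrichedOfFullyFaithful hG
  refine ⟨e, ⟨{
    map x y := c.map x y ≫ F x y ≫ F' x y
    map_comp x y z := ?_
    map_hom {x y} f := ?_
    isIso_map x y _ _ := ?_ }⟩⟩
  · have h := c.map_comp x y z =≫ (F x z ≫ F' x z)
    rw [assoc, assoc, assoc, reassoc_of% hcF x y z, hcF' x y z] at h
    refine h.trans ?_
    rw [tensorHom_comp_tensorHom_assoc, tensorHom_comp_tensorHom_assoc, assoc, assoc]
    rfl
  -- The lift is a map `Qx ⟶ Qy` over `f`; `F` sends the class of `f` to the class of this lift.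
  · have sq : CommSq (initial.to _) (initial.to (Z x).Q) (Z y).q ((Z x).q ≫ f) := ⟨by simp⟩
    have h₁ : eHomEquiv H (J.map f) ≫ F x y = eHomEquiv H (J.map sq.lift) := by
      rw [← cancel_mono (eHomWhiskerLeft H _ (J.map (Z y).q)), assoc, hF,
        eHomEquiv_eHomWhiskerRight, eHomEquiv_eHomWhiskerLeft, ← J.map_comp, ← J.map_comp,
        sq.fac_right]
    have h₂ : eHomEquiv H (J.map sq.lift) ≫ F' x y = eHomEquiv H (G.map (γC.map f)) := by
      rw [← cancel_mono (eHomWhiskerRight H (hπ.toModel γ R Z x) _), assoc, hF',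
        eHomEquiv_eHomWhiskerRight, eHomEquiv_eHomWhiskerLeft,
        hπ.map_comp_toModel γ R Z sq.fac_right]
    have h₃ := c.map_hom f =≫ (F x y ≫ F' x y)
    rw [assoc, assoc, reassoc_of% h₁, h₂] at h₃
    exact h₃
  -- For `x` cofibrant and `y` fibrant, `Qy` is fibrant as well, so Ken Brown's lemma makes the
  -- remaining maps in `hF` and `hF'` invertible.
  · have : IsFibrant (Z y).Q := isFibrant_of_fibration (Z y).q
    have := hE.weakEquivalence_whiskerRight (Z x).q y
    have := hE.weakEquivalence_whiskerLeft (Z x).Q (Z y).j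
    have : IsIso (eHomWhiskerRight H (J.map (Z x).q) (J.obj y)) := c.isIso_whiskerRight _ _
    have : IsIso (eHomWhiskerLeft H (J.obj (Z x).Q) (J.map (Z y).j)) := c.isIso_whiskerLeft _ _
    have : IsIso (eHomWhiskerLeft H (J.obj (Z x).Q) (hπ.toModel γ R Z y)) := by
      obtain ⟨u, _, hu⟩ := hπ.exists_toModel_eq γ R Z y
      rw [hu, eHomWhiskerLeft_comp]
      infer_instance
    have : IsIso (F x y) := IsIso.of_isIso_fac_right (hF x y)
    have : IsIso (F' x y) := IsIso.of_isIso_fac_right (hF' x y)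
    exact inferInstanceAs (IsIso (c.map x y ≫ F x y ≫ F' x y))

end Derived

/-! ### Actions on internal homs and the enriched Yoneda lemma -/

section Action

variable {W : Type u₁} [Category.{v₁} W] [MonoidalCategory W] [MonoidalClosed W]

lemma ihom_hom_ext {w a b : W} {f g : a ⟶ (ihom w).obj b}
    (h : w ◁ f ≫ (ihom.ev w).app b = w ◁ g ≫ (ihom.ev w).app b) : f = g :=
  MonoidalClosed.uncurry_injective (by rwa [MonoidalClosed.uncurry_eq, MonoidalClosed.uncurry_eq])

section

variable {D : Type u₂} [EnrichedCategory W D]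

lemma whiskerLeft_ihomAction_ev (w : W) (x y y' : D) :
    w ◁ ihomAction w x y y' ≫ (ihom.ev w).app _ =
      (α_ _ _ _).inv ≫ (ihom.ev w).app _ ▷ _ ≫ eComp W x y y' :=
  MonoidalClosed.whiskerLeft_curry_ihom_ev_app _ _ _

lemma ihomAction_ihomAction (w : W) (x y y' y'' : D) :
    ihomAction w x y y' ▷ _ ≫ ihomAction w x y' y'' =
      (α_ _ _ _).hom ≫ _ ◁ eComp W y y' y'' ≫ ihomAction w x y y'' := by
  apply ihom_hom_ext
  simp only [MonoidalCategory.whiskerLeft_comp, assoc, whiskerLeft_ihomAction_ev]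
  rw [associator_inv_naturality_right_assoc, whisker_exchange_assoc]
  dsimp only [Functor.id_obj]
  rw [← e_assoc, associator_inv_naturality_middle_assoc, ← comp_whiskerRight_assoc,
    whiskerLeft_ihomAction_ev]
  simp [e_assoc']

lemma ihomAction_pre {w w' : W} (g : w' ⟶ w) (x y y' : D) :
    ihomAction w x y y' ≫ (MonoidalClosed.pre g).app _ =
      (MonoidalClosed.pre g).app _ ▷ _ ≫ ihomAction w' x y y' := by
  apply ihom_hom_ext
  simp only [MonoidalCategory.whiskerLeft_comp, assoc, whiskerLeft_ihomAction_ev,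
    MonoidalClosed.id_tensor_pre_app_comp_ev]
  rw [associator_inv_naturality_middle_assoc, ← comp_whiskerRight_assoc,
    MonoidalClosed.id_tensor_pre_app_comp_ev, whisker_exchange_assoc, whiskerLeft_ihomAction_ev]
  simp

/-- The `W`-natural map `D(z, y) ⟶ W(w, D(x, y))` which corresponds to an element
of `W(w, D(x, z))`. -/
def actOn {w : W} {x z : D} (m : 𝟙_ W ⟶ (ihom w).obj (EnrichedCategory.Hom x z)) (y : D) :
    (EnrichedCategory.Hom z y : W) ⟶ (ihom w).obj (EnrichedCategory.Hom x y) :=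
  (λ_ _).inv ≫ m ▷ _ ≫ ihomAction w x z y

/-- Associativity of the action. It makes `actOn m` a natural family, as tensors require. -/
lemma eComp_actOn {w : W} {x z : D} (m : 𝟙_ W ⟶ (ihom w).obj (EnrichedCategory.Hom x z))
    (y y' : D) :
    eComp W z y y' ≫ actOn m y' = actOn m y ▷ _ ≫ ihomAction w x y y' := by
  simp only [actOn, comp_whiskerRight, assoc, ihomAction_ihomAction]
  rw [leftUnitor_inv_naturality_assoc, whisker_exchange_assoc]
  simp

/-- A tensor of `x` by `w` in a `W`-category `D`: an object which represents the
`W`-functor `W(w, D(x, -))`. -/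
structure TensorObj (w : W) (x : D) where
  /-- the representing object -/
  obj : D
  /-- the isomorphism `D(obj, y) ≅ W(w, D(x, y))` -/
  iso (y : D) : (EnrichedCategory.Hom obj y : W) ≅ (ihom w).obj (EnrichedCategory.Hom x y)
  natural (y y' : D) :
    eComp W obj y y' ≫ (iso y').hom = (iso y).hom ▷ _ ≫ ihomAction w x y y'

namespace TensorObj

variable {w : W} {x : D} (t : TensorObj w x)

/-- Enriched Yoneda: naturality recovers the whole family from its value at the identity. -/
lemma iso_hom_eq_actOn (y : D) : (t.iso y).hom = actOn (eId W t.obj ≫ (t.iso t.obj).hom) y := by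
  rw [actOn, comp_whiskerRight, assoc, ← t.natural, e_id_comp_assoc]

end TensorObj

end

section

variable {D : Type u₂} [Category.{v₂} D] [EnrichedOrdinaryCategory W D]

lemma whiskerLeft_eHomEquiv_ihomAction (w : W) (x : D) {y y' : D} (g : y ⟶ y') :
    _ ◁ eHomEquiv W g ≫ ihomAction w x y y' =
      (ρ_ _).hom ≫ (ihom w).map (eHomWhiskerLeft W x g) := by
  apply ihom_hom_ext
  simp only [MonoidalCategory.whiskerLeft_comp, assoc, whiskerLeft_ihomAction_ev]
  rw [ihom.ev_naturality, eHomWhiskerLeft, associator_inv_naturality_right_assoc,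
    whisker_exchange_assoc]
  simp

lemma eHomEquiv_actOn {w : W} {x z : D} (m : 𝟙_ W ⟶ (ihom w).obj (EnrichedCategory.Hom x z))
    {y : D} (g : z ⟶ y) :
    eHomEquiv W g ≫ actOn m y = m ≫ (ihom w).map (eHomWhiskerLeft W x g) := by
  rw [actOn, leftUnitor_inv_naturality_assoc, whisker_exchange_assoc,
    whiskerLeft_eHomEquiv_ihomAction]
  simp [unitors_inv_equal]

lemma eHomWhiskerRight_actOn {w : W} {x z z' : D}
    (m : 𝟙_ W ⟶ (ihom w).obj (EnrichedCategory.Hom x z)) (g : z ⟶ z') (y : D) :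
    eHomWhiskerRight W g y ≫ actOn m y = actOn (m ≫ (ihom w).map (eHomWhiskerLeft W x g)) y := by
  rw [eHomWhiskerRight, assoc, assoc, eComp_actOn, ← comp_whiskerRight_assoc, eHomEquiv_actOn]
  rfl

lemma eHomWhiskerLeft_natural {w : W} {x z : D}
    {t : ∀ y : D, (EnrichedCategory.Hom z y : W) ⟶ (ihom w).obj (EnrichedCategory.Hom x y)}
    (ht : ∀ y y', eComp W z y y' ≫ t y' = t y ▷ _ ≫ ihomAction w x y y') {y y' : D} (g : y ⟶ y') :
    eHomWhiskerLeft W z g ≫ t y' = t y ≫ (ihom w).map (eHomWhiskerLeft W x g) := by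
  rw [eHomWhiskerLeft, assoc, assoc, ht, whisker_exchange_assoc, whiskerLeft_eHomEquiv_ihomAction]
  simp

lemma ihomAction_map_eHomWhiskerRight (w : W) {x x' : D} (f : x' ⟶ x) (y y' : D) :
    ihomAction w x y y' ≫ (ihom w).map (eHomWhiskerRight W f y') =
      (ihom w).map (eHomWhiskerRight W f y) ▷ _ ≫ ihomAction w x' y y' := by
  apply ihom_hom_ext
  simp only [MonoidalCategory.whiskerLeft_comp, assoc, whiskerLeft_ihomAction_ev]
  rw [ihom.ev_naturality, reassoc_of% (whiskerLeft_ihomAction_ev w x y y'), eComp_eHomWhiskerRight,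
    associator_inv_naturality_middle_assoc, ← comp_whiskerRight_assoc]
  have h := ihom.ev_naturality w (eHomWhiskerRight W f y)
  dsimp at h
  rw [← comp_whiskerRight_assoc, h]

instance {w w' : W} (g : w ⟶ w') [IsIso g] : IsIso (MonoidalClosed.pre g) :=
  ⟨MonoidalClosed.pre (inv g), by rw [← MonoidalClosed.pre_map]; simp,
    by rw [← MonoidalClosed.pre_map]; simp⟩

namespace TensorObj

variable {w : W} {x : D}

/-- The transport of a tensor along isomorphisms. -/
@[simps obj]
def ofIso (t : TensorObj w x) {w' : W} {x' : D} (e : w ≅ w') (e' : x ≅ x') : TensorObj w' x' where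
  obj := t.obj
  iso y := t.iso y ≪≫ asIso ((MonoidalClosed.pre e.inv).app _) ≪≫
    asIso ((ihom w').map (eHomWhiskerRight W e'.inv y))
  natural y y' := by
    simp [reassoc_of% t.natural, reassoc_of% (@ihomAction_pre), ihomAction_map_eHomWhiskerRight]

variable (t t' : TensorObj w x)

/-- The comparison map between two tensors of `x` by `w`. -/
def comparison : t.obj ⟶ t'.obj :=
  (eHomEquiv W).symm (eId W t'.obj ≫ (t'.iso t'.obj).hom ≫ (t.iso t'.obj).inv)

lemma eHomWhiskerRight_comparison (y : D) :
    eHomWhiskerRight W (comparison t t') y ≫ (t.iso y).hom = (t'.iso y).hom := by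
  rw [t.iso_hom_eq_actOn, eHomWhiskerRight_actOn, ← eHomEquiv_actOn, ← t.iso_hom_eq_actOn,
    comparison, Equiv.apply_symm_apply, assoc, assoc, Iso.inv_hom_id, comp_id,
    ← t'.iso_hom_eq_actOn]

lemma comparison_comp : comparison t t' ≫ comparison t' t = 𝟙 _ := by
  have h : eHomWhiskerRight W (comparison t t' ≫ comparison t' t) t.obj = 𝟙 _ := by
    rw [← cancel_mono (t.iso _).hom, eHomWhiskerRight_comp, assoc, eHomWhiskerRight_comparison,
      eHomWhiskerRight_comparison, id_comp]
  have h' := eHomEquiv W (𝟙 t.obj) ≫= h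
  rw [eHomEquiv_eHomWhiskerRight, comp_id, comp_id] at h'
  exact (eHomEquiv W).injective h'

/-- Two tensors of `x` by `w` are isomorphic. -/
@[simps]
def uniqueUpToIso : t.obj ≅ t'.obj where
  hom := comparison t t'
  inv := comparison t' t
  hom_inv_id := comparison_comp _ _
  inv_hom_id := comparison_comp _ _

end TensorObj

end

end Action

open Functor.LaxMonoidal

section LaxMonoidal

variable {V : Type u₁} [Category.{v₁} V] [MonoidalCategory V]
  {C : Type u₂} [Category.{v₂} C] [EnrichedOrdinaryCategory V C]
  {H : Type u₃} [Category.{v₃} H] [MonoidalCategory H] (γ : V ⥤ H) [γ.LaxMonoidal]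

lemma map_eHomWhiskerLeft (x : C) {y y' : C} (g : y ⟶ y') :
    γ.map (eHomWhiskerLeft V x g) =
      (ρ_ _).inv ≫ _ ◁ (ε γ ≫ γ.map (eHomEquiv V g)) ≫ μ γ _ _ ≫ γ.map (eComp V x y y') := by
  rw [eHomWhiskerLeft, γ.map_comp, γ.map_comp, MonoidalCategory.whiskerLeft_comp_assoc,
    μ_natural_right_assoc, right_unitality_inv_assoc]

lemma map_eHomWhiskerRight {x x' : C} (f : x ⟶ x') (y : C) :
    γ.map (eHomWhiskerRight V f y) =
      (λ_ _).inv ≫ (ε γ ≫ γ.map (eHomEquiv V f)) ▷ _ ≫ μ γ _ _ ≫ γ.map (eComp V x x' y) := by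
  rw [eHomWhiskerRight, γ.map_comp, γ.map_comp, comp_whiskerRight_assoc,
    μ_natural_left_assoc, left_unitality_inv_assoc]

end LaxMonoidal

/-! ### Equivariant families and representability -/

section TensorObj

variable {V : Type u₁} [Category.{v₁} V] [MonoidalCategory V]
  {C : Type u₂} [Category.{v₂} C] [EnrichedOrdinaryCategory V C] [ModelCategory C]
  {H : Type u₃} [Category.{v₃} H] [MonoidalCategory H] {γ : V ⥤ H} [γ.LaxMonoidal]
  {H' : Type u₄} [Category.{v₄} H'] [EnrichedOrdinaryCategory H H'] {γC : C ⥤ H'}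

/-- The comparison of hom-objects given by a derived enrichment. -/
@[simps]
def DerivedEnrichment.toHomComparison (E : DerivedEnrichment γ γC) : HomComparison γ γC where
  map := E.map
  map_comp := E.map_comp
  map_hom := E.map_hom

variable [MonoidalClosed H] (E : DerivedEnrichment γ γC) {w : H} {X : H'} {z : C}

/-- Compatibility of maps `γ C(z, y) ⟶ W(w, H'(X, γC y))` with the actions on both sides. -/
def IsEquivariant
    (a : ∀ y : C, γ.obj (EnrichedCategory.Hom z y) ⟶
      (ihom w).obj (EnrichedCategory.Hom X (γC.obj y))) : Prop :=
  ∀ y y', μ γ _ _ ≫ γ.map (eComp V z y y') ≫ a y' =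
    (a y ⊗ₘ E.map y y') ≫ ihomAction w X (γC.obj y) (γC.obj y')

variable {E} {a : ∀ y : C, γ.obj (EnrichedCategory.Hom z y) ⟶
  (ihom w).obj (EnrichedCategory.Hom X (γC.obj y))}

namespace IsEquivariant

lemma whiskerLeft (ha : IsEquivariant E a) {y y' : C} (g : y ⟶ y') :
    γ.map (eHomWhiskerLeft V z g) ≫ a y' =
      a y ≫ (ihom w).map (eHomWhiskerLeft H X (γC.map g)) := by
  rw [map_eHomWhiskerLeft, assoc, assoc, assoc, ha, tensorHom_def'_assoc,
    ← MonoidalCategory.whiskerLeft_comp_assoc, assoc, E.map_hom, whisker_exchange_assoc,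
    whiskerLeft_eHomEquiv_ihomAction]
  simp

lemma precomp (ha : IsEquivariant E a) {z' : C} (b : 𝟙_ H ⟶ γ.obj (EnrichedCategory.Hom z z'))
    (y : C) :
    (λ_ _).inv ≫ b ▷ _ ≫ μ γ _ _ ≫ γ.map (eComp V z z' y) ≫ a y =
      E.map z' y ≫ actOn (b ≫ a z') (γC.obj y) := by
  rw [ha, tensorHom_def_assoc, ← comp_whiskerRight_assoc, actOn,
    leftUnitor_inv_naturality_assoc, whisker_exchange_assoc]

lemma whiskerRight (ha : IsEquivariant E a) {z' : C} (j : z ⟶ z') (y : C) :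
    γ.map (eHomWhiskerRight V j y) ≫ a y =
      E.map z' y ≫ actOn ((ε γ ≫ γ.map (eHomEquiv V j)) ≫ a z') (γC.obj y) := by
  rw [map_eHomWhiskerRight, assoc, assoc, assoc, ha.precomp]

variable [γC.IsLocalization (weakEquivalences C)]

/-- Here `z` is not assumed cofibrant, so `E.map z y` is not known to be invertible. Instead `γC z`
is modelled by a bifibrant `Q`, and the invertible map `E.map Q y` followed by an isomorphism
factors through `E.map z y`. -/
lemma epi_map (ha : IsEquivariant E a)
    (ha' : ∀ (y : C) [IsFibrant y], IsIso (a y)) (y : C) [IsFibrant y] : Epi (E.map z y) := by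
  obtain ⟨z', j, _, _, _⟩ := exists_fibrant_replacement z
  obtain ⟨Q, _, q, _, _⟩ := CofibrantObject.HoCat.exists_resolution z'
  have : IsFibrant Q := isFibrant_of_fibration q
  have := isIso_map_of_weakEquivalence γC j
  have := isIso_map_of_weakEquivalence γC q
  have := ha' z'
  have := ha' Q
  -- The family `a` turns this into postcomposition with the isomorphism `γC q`. Hence the class of
  -- `j` lifts to an element `b` of `γ C(z, Q)`, although `j` itself need not lift along `q`.
  have hq : IsIso (γ.map (eHomWhiskerLeft V z q)) :=
    IsIso.of_isIso_fac_right (ha.whiskerLeft q)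
  let b : 𝟙_ H ⟶ γ.obj (EnrichedCategory.Hom z Q) :=
    ε γ ≫ γ.map (eHomEquiv V j) ≫ inv (γ.map (eHomWhiskerLeft V z q))
  let b' : γC.obj z ⟶ γC.obj Q := (eHomEquiv H).symm (b ≫ E.map z Q)
  have hb' : b' ≫ γC.map q = γC.map j := by
    apply (eHomEquiv H).injective
    rw [← eHomEquiv_eHomWhiskerLeft, Equiv.apply_symm_apply, ← E.map_hom, assoc]
    have h : γ.map (eHomWhiskerLeft V z q) ≫ E.map z z' =
      E.map z Q ≫ eHomWhiskerLeft H (γC.obj z) (γC.map q) := E.toHomComparison.whiskerLeft_map z q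
    rw [← h]
    simp [b]
  have : IsIso b' := IsIso.of_isIso_fac_right hb'
  have := E.isIso_map Q y
  have h : ((λ_ _).inv ≫ b ▷ _ ≫ μ γ _ _ ≫ γ.map (eComp V z Q y)) ≫ E.map z y =
      E.map Q y ≫ eHomWhiskerRight H b' (γC.obj y) := by
    rw [eHomWhiskerRight, Equiv.apply_symm_apply, assoc, assoc, assoc, E.map_comp,
      tensorHom_def_assoc, ← comp_whiskerRight_assoc, leftUnitor_inv_naturality_assoc,
      whisker_exchange_assoc]
  exact epi_of_epi_fac h

variable [ModelCategory V] [γ.IsLocalization (weakEquivalences V)]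

/-- The element of `W(w, H'(X, γC z))` which corresponds to an equivariant family of maps. -/
lemma exists_actOn_eq (hE : EHomHomotopical V C) (ha : IsEquivariant E a) :
    ∃ m : 𝟙_ H ⟶ (ihom w).obj (EnrichedCategory.Hom X (γC.obj z)),
      ∀ y, E.map z y ≫ actOn m (γC.obj y) = a y := by
  obtain ⟨z', j, _, _, _⟩ := exists_fibrant_replacement z
  have := isIso_map_of_weakEquivalence γC j
  -- The image of `j` under `a z'`, carried back along the inverse of `γC j`.
  let m := ((ε γ ≫ γ.map (eHomEquiv V j)) ≫ a z') ≫
    (ihom w).map (eHomWhiskerLeft H X (inv (γC.map j)))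
  have h₁ (y : C) [IsFibrant y] : E.map z y ≫ actOn m (γC.obj y) = a y := by
    have := hE.weakEquivalence_whiskerRight_of_cofibration j y
    have := isIso_map_of_weakEquivalence γ (eHomWhiskerRight V j y)
    rw [← cancel_epi (γ.map (eHomWhiskerRight V j y)), ha.whiskerRight]
    have h := reassoc_of% (E.toHomComparison.whiskerRight_map j y)
    refine (h (actOn m (γC.obj y))).trans ?_
    rw [eHomWhiskerRight_actOn]
    simp only [m, assoc, ← Functor.map_comp, ← eHomWhiskerLeft_comp]
    simp
  refine ⟨m, fun y ↦ ?_⟩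
  -- Both sides are natural in `y`, and `γC k` is invertible, so the fibrant case suffices.
  obtain ⟨y', k, _, _, _⟩ := exists_fibrant_replacement y
  have := isIso_map_of_weakEquivalence γC k
  rw [← cancel_mono ((ihom w).map (eHomWhiskerLeft H X (γC.map k))), ← ha.whiskerLeft, ← h₁ y',
    assoc, ← eHomWhiskerLeft_natural (eComp_actOn m)]
  exact (reassoc_of% (E.toHomComparison.whiskerLeft_map z k)) _ |>.symm

/-- If an equivariant family of maps is invertible on fibrant objects, then `γC z` is a tensor. -/
theorem exists_iso (hE : EHomHomotopical V C) (ha : IsEquivariant E a)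
    (ha' : ∀ (y : C) [IsFibrant y], IsIso (a y)) :
    ∃ t : TensorObj w X, ∃ e : t.obj ≅ γC.obj z, ∀ y : C,
      E.map z y ≫ eHomWhiskerRight H e.hom (γC.obj y) ≫ (t.iso (γC.obj y)).hom = a y := by
  obtain ⟨m, hm⟩ := ha.exists_actOn_eq hE
  have h₁ (Y : H') : IsIso (actOn m Y) := by
    obtain ⟨y, _, ⟨e⟩⟩ := exists_fibrant_iso γC Y
    have := ha' y
    have := ha.epi_map ha' y
    -- The factorization `hm` gives one inverse law at once; the other one needs `E.map z y` to be
    -- epi.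
    have h : actOn m (γC.obj y) ≫ inv (a y) ≫ E.map z y = 𝟙 _ := by
      rw [← cancel_epi (E.map z y), reassoc_of% hm]
      simp
    have h' : (inv (a y) ≫ E.map z y) ≫ actOn m (γC.obj y) = 𝟙 _ := by
      rw [assoc, hm, IsIso.inv_hom_id]
    have : IsIso (actOn m (γC.obj y)) := ⟨_, h, h'⟩
    exact IsIso.of_isIso_fac_left (eHomWhiskerLeft_natural (eComp_actOn m) e.hom)
  refine ⟨{ obj := γC.obj z, iso Y := asIso (actOn m Y), natural := eComp_actOn m },
    Iso.refl _, fun y ↦ ?_⟩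
  simp [hm]

end IsEquivariant

end TensorObj

open Functor.LaxMonoidal

/-! ### Tensorings of the homotopy category -/

section Tensoring

variable {V : Type u₁} [Category.{v₁} V] [MonoidalCategory V] [MonoidalClosed V]
  {C : Type u₂} [Category.{v₂} C] [EnrichedOrdinaryCategory V C] [ModelCategory C]
  {H : Type u₃} [Category.{v₃} H] [MonoidalCategory H] [MonoidalClosed H]
  {γ : V ⥤ H} [γ.LaxMonoidal]
  {H' : Type u₄} [Category.{v₄} H'] [EnrichedOrdinaryCategory H H'] {γC : C ⥤ H'}
  (E : DerivedEnrichment γ γC)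

lemma whiskerLeft_ihomComparison_ev (v z : V) :
    γ.obj v ◁ ihomComparison γ v z ≫ (ihom.ev _).app _ = evComparison γ v z :=
  MonoidalClosed.whiskerLeft_curry_ihom_ev_app _ _ _

/-- The map `γ V(v, C(x, y)) ⟶ HoV(γ v, HoC(γ x, γ y))`. -/
def ihomMap (v : V) (x y : C) :
    γ.obj ((ihom v).obj (EnrichedCategory.Hom x y)) ⟶
      (ihom (γ.obj v)).obj (EnrichedCategory.Hom (γC.obj x) (γC.obj y)) :=
  ihomComparison γ v _ ≫ (ihom (γ.obj v)).map (E.map x y)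

lemma whiskerLeft_ihomMap_ev (v : V) (x y : C) :
    γ.obj v ◁ ihomMap E v x y ≫ (ihom.ev _).app _ = evComparison γ v _ ≫ E.map x y := by
  rw [ihomMap, MonoidalCategory.whiskerLeft_comp, assoc, ihom.ev_naturality,
    ← whiskerLeft_ihomComparison_ev, assoc]

/-- After evaluation at `v`, this reduces to the compatibility of `E` with composition and to the
lax associativity of `γ`. -/
lemma map_ihomAction_ihomMap (v : V) (x y y' : C) :
    μ γ _ _ ≫ γ.map (ihomAction v x y y') ≫ ihomMap E v x y' =
      (ihomMap E v x y ⊗ₘ E.map y y') ≫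
        ihomAction (γ.obj v) (γC.obj x) (γC.obj y) (γC.obj y') := by
  apply ihom_hom_ext
  simp only [MonoidalCategory.whiskerLeft_comp, assoc, whiskerLeft_ihomAction_ev,
    whiskerLeft_ihomMap_ev]
  rw [evComparison, assoc, μ_natural_right_assoc, ← γ.map_comp_assoc, whiskerLeft_ihomAction_ev,
    γ.map_comp_assoc, associativity_inv_assoc, γ.map_comp_assoc, ← μ_natural_left_assoc]
  dsimp only [Functor.id_obj]
  rw [E.map_comp, MonoidalCategory.tensorHom_def (ihomMap E v x y),
    MonoidalCategory.whiskerLeft_comp_assoc,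
    associator_inv_naturality_right_assoc, associator_inv_naturality_middle_assoc,
    whisker_exchange_assoc, ← comp_whiskerRight_assoc, ← comp_whiskerRight_assoc,
    whiskerLeft_ihomMap_ev, evComparison]
  simp [MonoidalCategory.tensorHom_def]

lemma isEquivariant_ihomMap {v : V} {x z : C}
    (φ : ∀ y : C, (EnrichedCategory.Hom z y : V) ⟶ (ihom v).obj (EnrichedCategory.Hom x y))
    (hφ : ∀ y y', eComp V z y y' ≫ φ y' = φ y ▷ _ ≫ ihomAction v x y y') :
    IsEquivariant E (fun y ↦ γ.map (φ y) ≫ ihomMap E v x y) := by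
  intro y y'
  dsimp
  rw [← γ.map_comp_assoc, hφ, γ.map_comp_assoc, ← μ_natural_left_assoc, map_ihomAction_ihomMap,
    tensorHom_def_assoc,
    tensorHom_def_assoc, comp_whiskerRight_assoc]

variable [ModelCategory V] [SymmetricCategory V] [γ.IsLocalization (weakEquivalences V)]
  [γC.IsLocalization (weakEquivalences C)]

/-- A family of objects `z x v` of `C` which are weak tensors of `x` by `v`
for all cofibrant `x` and `v` induces a tensoring of the homotopy category. -/
theorem exists_tensoring (hV : IsMonoidalModelCategory V) (hγ : IsDerivedMonoidal γ)
    (hE : EHomHomotopical V C) (z : C → V → C)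
    (φ : ∀ (v : V) (x y : C),
      (EnrichedCategory.Hom (z x v) y : V) ⟶ (ihom v).obj (EnrichedCategory.Hom x y))
    (natural : ∀ (v : V) (x y y' : C),
      eComp V (z x v) y y' ≫ φ v x y' = φ v x y ▷ _ ≫ ihomAction v x y y')
    (weakEquivalence : ∀ (v : V) (x y : C) [IsCofibrant v] [IsCofibrant x] [IsFibrant y],
      WeakEquivalence (φ v x y)) :
    ∃ t : Tensoring H H', ∀ (x : C) (v : V) [IsCofibrant x] [IsCofibrant v],
      ∃ e : t.obj (γC.obj x) (γ.obj v) ≅ γC.obj (z x v), ∀ y : C,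
        E.map (z x v) y ≫ eHomWhiskerRight H e.hom (γC.obj y) ≫
            (t.iso (γ.obj v) (γC.obj x) (γC.obj y)).hom =
          γ.map (φ v x y) ≫ ihomComparison γ v _ ≫ (ihom (γ.obj v)).map (E.map x y) := by
  have key (x : C) (v : V) [IsCofibrant x] [IsCofibrant v] :
      ∃ t : TensorObj (γ.obj v) (γC.obj x), ∃ e : t.obj ≅ γC.obj (z x v), ∀ y : C,
        E.map (z x v) y ≫ eHomWhiskerRight H e.hom (γC.obj y) ≫ (t.iso (γC.obj y)).hom =
          γ.map (φ v x y) ≫ ihomMap E v x y := by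
    refine (isEquivariant_ihomMap E (φ v x) (natural v x)).exists_iso hE fun y _ ↦ ?_
    have := weakEquivalence v x y
    have := isIso_map_of_weakEquivalence γ (φ v x y)
    have := hE.isFibrant x y
    have := isIso_ihomComparison γ hV hγ v (EnrichedCategory.Hom x y)
    have := E.isIso_map x y
    dsimp only [ihomMap]
    infer_instance
  -- Arbitrary objects have cofibrant models, and tensors transport along isomorphisms.
  have (X : H') (W : H) : Nonempty (TensorObj W X) := by
    obtain ⟨x, _, ⟨e⟩⟩ := exists_cofibrant_iso γC X
    obtain ⟨v, _, ⟨e'⟩⟩ := exists_cofibrant_iso γ W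
    exact ⟨(key x v).choose.ofIso e' e⟩
  let T (X : H') (W : H) : TensorObj W X := Classical.arbitrary _
  refine ⟨{ obj X W := (T X W).obj
            iso W X Y := (T X W).iso Y
            natural W X := (T X W).natural }, fun x v _ _ ↦ ?_⟩
  obtain ⟨t, e, he⟩ := key x v
  -- The globally chosen tensor `T` may differ from the one built from `z x v`; uniqueness of
  -- representing objects compares them.
  refine ⟨(TensorObj.uniqueUpToIso (T _ _) t) ≪≫ e, fun y ↦ (Eq.trans ?_ (he y))⟩
  simp only [Iso.trans_hom, TensorObj.uniqueUpToIso_hom, eHomWhiskerRight_comp, assoc,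
    TensorObj.eHomWhiskerRight_comparison]

/-- A weak tensoring induces a tensoring of the homotopy category. -/
theorem WeakTensoring.exists_induces (hV : IsMonoidalModelCategory V) (hγ : IsDerivedMonoidal γ)
    (hE : EHomHomotopical V C) (T : WeakTensoring V C) :
    ∃ t : Tensoring H H', T.Induces E t :=
  exists_tensoring E hV hγ hE (fun x v ↦ (T.tensor.obj x).obj v) T.φ T.natural_right
    T.weakEquivalence_φ

end Tensoring

open Functor.LaxMonoidal

/-! ### Cotensorings by passage to opposite categories -/

section OppositeAction

variable {W : Type u₁} [Category.{v₁} W] [MonoidalCategory W] [MonoidalClosed W]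
  [BraidedCategory W] {D : Type u₂} [EnrichedCategory W D]

/-- Composition in `Dᵒᵖ` is that of `D` precomposed with the braiding, so the two actions differ by
a braiding. -/
lemma braiding_hom_ihomCoaction (w : W) (x y y' : D) :
    (β_ _ _).hom ≫ ihomCoaction w y' y x = ihomAction w (op x) (op y) (op y') := by
  apply ihom_hom_ext
  refine Eq.trans ?_ (whiskerLeft_ihomAction_ev w (op x) (op y) (op y')).symm
  change _ = (α_ _ _ _).inv ≫ (ihom.ev w).app (EnrichedCategory.Hom y x) ▷ _ ≫
    (β_ _ _).hom ≫ eComp W y' y x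
  rw [BraidedCategory.braiding_naturality_left_assoc]
  change _ = _ ≫ (β_ (w ⊗ _) _).hom ≫ _
  rw [BraidedCategory.braiding_tensor_left_hom, MonoidalCategory.whiskerLeft_comp_assoc,
    ihomCoaction,
    MonoidalClosed.whiskerLeft_curry_ihom_ev_app]
  simp

/-- The cotensoring which is given by a tensoring of the opposite category. -/
@[simps obj iso]
def Tensoring.unop (t : Tensoring W Dᵒᵖ) : Cotensoring W D where
  obj y w := (t.obj (op y) w).unop
  iso w x y := t.iso w (op y) (op x)
  natural w x' x y := by
    have h := t.natural w (op y) (op x) (op x')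
    rw [← braiding_hom_ihomCoaction] at h
    rw [← cancel_epi (β_ _ _).hom, ← BraidedCategory.braiding_naturality_left_assoc]
    refine Eq.trans ?_ h
    rw [eComp_op_eq, assoc]

end OppositeAction

section OppositeEnrichment

variable {V : Type u₁} [Category.{v₁} V] [MonoidalCategory V] [BraidedCategory V]
  {C : Type u₂} [Category.{v₂} C] [EnrichedOrdinaryCategory V C] [ModelCategory C]
  {H : Type u₃} [Category.{v₃} H] [MonoidalCategory H] [BraidedCategory H]
  {γ : V ⥤ H} [γ.LaxBraided]
  {H' : Type u₄} [Category.{v₄} H'] [EnrichedOrdinaryCategory H H'] {γC : C ⥤ H'}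

/-- The derived enrichment of the opposite category. -/
@[simps map]
def DerivedEnrichment.op (E : DerivedEnrichment γ γC) : DerivedEnrichment γ γC.op where
  map x y := E.map y.unop x.unop
  map_comp x y z := by
    change μ γ _ _ ≫ γ.map ((β_ _ _).hom ≫ eComp V z.unop y.unop x.unop) ≫ E.map z.unop x.unop =
      (E.map y.unop x.unop ⊗ₘ E.map z.unop y.unop) ≫ (β_ _ _).hom ≫
        eComp H (γC.obj z.unop) (γC.obj y.unop) (γC.obj x.unop)
    rw [γ.map_comp_assoc, Functor.LaxBraided.braided_assoc, E.map_comp,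
      BraidedCategory.braiding_naturality_assoc]
  map_hom f := E.map_hom f.unop
  isIso_map x y _ _ := by
    have := isFibrant_unop x
    have := isCofibrant_unop y
    exact E.isIso_map y.unop x.unop

end OppositeEnrichment

section Cotensoring

variable {V : Type u₁} [Category.{v₁} V] [MonoidalCategory V] [MonoidalClosed V]
  {C : Type u₂} [Category.{v₂} C] [EnrichedOrdinaryCategory V C] [ModelCategory C]
  {H : Type u₃} [Category.{v₃} H] [MonoidalCategory H] [MonoidalClosed H] [SymmetricCategory H]
  [ModelCategory V] [SymmetricCategory V] {γ : V ⥤ H} [γ.LaxBraided]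
  {H' : Type u₄} [Category.{v₄} H'] [EnrichedOrdinaryCategory H H'] {γC : C ⥤ H'}
  (E : DerivedEnrichment γ γC) [γ.IsLocalization (weakEquivalences V)]
  [γC.IsLocalization (weakEquivalences C)]

/-- A weak cotensoring induces a cotensoring of the homotopy category. -/
theorem WeakCotensoring.exists_induces (hV : IsMonoidalModelCategory V) (hγ : IsDerivedMonoidal γ)
    (hE : EHomHomotopical V C) (T : WeakCotensoring V C) :
    ∃ t : Cotensoring H H', T.Induces E t := by
  have : γC.op.IsLocalization (weakEquivalences Cᵒᵖ) := by
    rw [weakEquivalences_op]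
    infer_instance
  obtain ⟨t, ht⟩ := exists_tensoring E.op hV hγ hE.op
    (fun y v ↦ op ((T.cotensor.obj (op v)).obj y.unop)) (fun v y x ↦ T.ψ v x.unop y.unop)
    (fun v y x x' ↦ by
      change ((β_ _ _).hom ≫ eComp V x'.unop x.unop _) ≫ _ = _
      rw [assoc, T.natural_middle]
      refine (BraidedCategory.braiding_naturality_left_assoc _ _ _).symm.trans ?_
      rw [braiding_hom_ihomCoaction]
      rfl)
    (fun v y x _ _ _ ↦ by
      have := isFibrant_unop y
      have := isCofibrant_unop x
      exact T.weakEquivalence_ψ v x.unop y.unop)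
  refine ⟨t.unop, fun y v _ _ ↦ ?_⟩
  have := isCofibrant_op y
  obtain ⟨e, he⟩ := ht (op y) v
  refine ⟨e.unop, fun x ↦ ?_⟩
  -- Precomposition in the opposite category is postcomposition with `e.unop`, which turns the
  -- tensoring identity into the cotensoring one.
  have h := he (op x)
  rw [eHomWhiskerRight_op] at h
  exact h

end Cotensoring

end EnrichedModel

end

theorem proposition6p8
    {V : Type u₁} [Category.{v₁} V] [MonoidalCategory V] [SymmetricCategory V] [MonoidalClosed V]
    [ModelCategory V] (hV : EnrichedModel.IsMonoidalModelCategory V)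
    {C : Type u₂} [Category.{v₂} C] [EnrichedOrdinaryCategory V C] [ModelCategory C]
    (hC : EnrichedModel.EnrichedInitialTerminal V C)
    (hSM7 : EnrichedModel.SM7 V C)
    {HoV : Type u₃} [Category.{v₃} HoV] (γV : V ⥤ HoV) [γV.IsLocalization (weakEquivalences V)]
    {HoC : Type u₄} [Category.{v₄} HoC] (γC : C ⥤ HoC) [γC.IsLocalization (weakEquivalences C)]
    (hπ : EnrichedModel.PiZeroAxiom γV γC) :
    -- the derived closed symmetric monoidal structure on `HoV` exists
    (∃ (_ : MonoidalCategory HoV) (_ : SymmetricCategory HoV) (_ : MonoidalClosed HoV)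
        (_ : γV.LaxBraided), EnrichedModel.IsDerivedMonoidal γV) ∧
    -- and for any such structure
    ∀ [MonoidalCategory HoV] [SymmetricCategory HoV] [MonoidalClosed HoV] [γV.LaxBraided],
      EnrichedModel.IsDerivedMonoidal γV →
      -- the category `HoC` has an induced enrichment in `HoV`
      (∃ _ : EnrichedOrdinaryCategory HoV HoC,
        Nonempty (EnrichedModel.DerivedEnrichment γV γC)) ∧
      -- and for any such enrichment, weak (co)tensorings induce (co)tensorings
      ∀ [EnrichedOrdinaryCategory HoV HoC] (E : EnrichedModel.DerivedEnrichment γV γC),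
        (∀ T : EnrichedModel.WeakTensoring V C,
          ∃ t : EnrichedModel.Tensoring HoV HoC, T.Induces E t) ∧
        (∀ T : EnrichedModel.WeakCotensoring V C,
          ∃ t : EnrichedModel.Cotensoring HoV HoC, T.Induces E t) := by
  have hE := hSM7.eHomHomotopical hC
  refine ⟨EnrichedModel.exists_derivedMonoidal γV hV, ?_⟩
  intro _ _ _ _ hγ
  refine ⟨EnrichedModel.exists_derivedEnrichment hE hγ hπ, ?_⟩
  intro _ E
  exact ⟨fun T ↦ EnrichedModel.WeakTensoring.exists_induces E hV hγ hE T,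
    fun T ↦ EnrichedModel.WeakCotensoring.exists_induces E hV hγ hE T⟩
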